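/- **Arenas and Muller games.** An arena $\mathcal A=(V,V_0,V_1,E)$ is a finite directed graph $(V,E)$ in which every vertex has an outgoing edge, with $V_0\subseteq V$ and $V_1=V\setminus V_0$ (the positions of Players $0$ and $1$). A play is an infinite path $\rho=\rho_0\rho_1\cdots$; a play prefix is a non-empty finite path. A loop is a non-empty set $C\subseteq V$ such that for all $v,v'\in C$ there is a path with at least one edge from $v$ to $v'$ that stays in $C$. A Muller game is $\mathcal G=(\mathcal A,\mathcal F_0,\mathcal F_1)$, where $\mathcal F_0$ is a set of loops and $\mathcal F_1$ is the set of all other loops; a play is won by Player $0$ if the set of vertices it visits infinitely often is in $\mathcal F_0$. In any game, $W_0$ denotes the set of vertices from which Player $0$ has a winning strategy (a strategy may depend on the whole history). **Scores.** For $F\subseteq V$ the score and the accumulator of words $w\in V^+$ are defined as follows. $\mathrm{Sc}_{\{v\}}(v)=1$, $\mathrm{Acc}_{\{v\}}(v)=\emptyset$, and $\mathrm{Sc}_F(v)=0$, $\mathrm{Acc}_F(v)=F\cap\{v\}$ for $F\neq\{v\}$. If $v\notin F$, then $\mathrm{Sc}_F(wv)=0$, $\mathrm{Acc}_F(wv)=\emptyset$.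 If $v\in F$ and $\mathrm{Acc}_F(w)=F\setminus\{v\}$, then $\mathrm{Sc}_F(wv)=\mathrm{Sc}_F(w)+1$, $\mathrm{Acc}_F(wv)=\emptyset$. If $v\in F$ and $\mathrm{Acc}_F(w)\ne F\setminus\{v\}$, then $\mathrm{Sc}_F(wv)=\mathrm{Sc}_F(w)$, $\mathrm{Acc}_F(wv)=\mathrm{Acc}_F(w)\cup\{v\}$. Player $1$'s maximal score $\mathrm{MaxSc}_{\mathcal F_1}(x)\in\mathbb N\cup\{\infty\}$ of a finite or infinite word $x$ is the supremum of $\mathrm{Sc}_F(w)$ over $F\in\mathcal F_1$ and non-empty finite prefixes $w$ of $x$ ($0$ if $\mathcal F_1=\emptyset$). **The safety game $\mathcal G_S$.** Call words $w,w'\in V^+$ equivalent if they have the same last letter and $\mathrm{Sc}_F(w)=\mathrm{Sc}_F(w')$, $\mathrm{Acc}_F(w)=\mathrm{Acc}_F(w')$ for all $F\in\mathcal F_1$; write $[w]$ for the class of $w$. Let $P_{<3}$ be the set of play prefixes $w$ with $\mathrm{MaxSc}_{\mathcal F_1}(w)<3$, and $P_{=3}$ the set of play prefixes $wv$ ($w\in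 V^+$, $v\in V$) with $\mathrm{MaxSc}_{\mathcal F_1}(w)\le 2$ and $\mathrm{MaxSc}_{\mathcal F_1}(wv)=3$. The vertices of $\mathcal G_S$ are the classes of the elements of $P_{<3}\cup P_{=3}$; $[w]$ belongs to Player $i$ if the last letter of $w$ is in $V_i$; the safe vertices are the classes of the elements of $P_{<3}$; there is an edge from $[w]$ to $[wv]$ whenever $w\in P_{<3}$ and there is an edge of $\mathcal A$ from the last letter of $w$ to $v$, and every unsafe vertex has just a self-loop. Player $0$ wins the plays of $\mathcal G_S$ that visit only safe vertices. **Multi-strategies.** A multi-strategy $\sigma$ for Player $0$ assigns to every word $wv$ with $w\in V^*$, $v\in V_0$ a non-empty set $\sigma(wv)$ of successors of $v$. $\mathrm{Beh}(v,\sigma)$ is the set of plays $\rho$ with $\rho_0=v$ and $\rho_{n+1}\in\sigma(\rho_0\cdots\rho_n)$ for all $n$ with $\rho_n\in V_0$. The multi-strategy $\sigma$ is finite-state with memory states $M$ if $M$ is a finite set and there are maps $\mathrm{init}\colon V\to M$, $\mathrm{upd}\colon M\times V\to M$ and a map $\mathrm{nxt}$ that assigns to every $(v,m)\in V_0\times M$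 a non-empty set of successors of $v$, such that $\sigma(wv)=\mathrm{nxt}(v,\mathrm{upd}^*(wv))$ for all $w\in V^*$, $v\in V_0$, where $\mathrm{upd}^*(v)=\mathrm{init}(v)$ for $v\in V$ and $\mathrm{upd}^*(wv)=\mathrm{upd}(\mathrm{upd}^*(w),v)$ for $w\in V^+$, $v\in V$. A multi-strategy $\sigma'$ for Player $0$ is permissive for $\mathcal G$ if 1. for every $v\in W_0(\mathcal G)$, every play in $\mathrm{Beh}(v,\sigma')$ is won by Player $0$, and 2. for every multi-strategy $\sigma$ for Player $0$ and every $v\in V$ such that $\mathrm{MaxSc}_{\mathcal F_1}(\rho)\le 2$ for all $\rho\in\mathrm{Beh}(v,\sigma)$, we have $\mathrm{Beh}(v,\sigma)\subseteq\mathrm{Beh}(v,\sigma')$. **Theorem.** Let $\mathcal G$ be a Muller game and $\mathcal G_S$ the safety game defined above. Then Player $0$ has a finite-state permissive multi-strategy for $\mathcal G$ with memory states $W_0(\mathcal G_S)$; in the degenerate case $W_0(\mathcal G_S)=\emptyset$, where (if $V\ne\emptyset$) no memory structure with an empty set of states exists, she has a finite-state permissive multi-strategy with a single memory state. -/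

import Mathlib

namespace MullerPermissive

universe u

/-! ## Arenas, plays and strategies -/

/-- An arena on the vertex set `V`: a finite directed graph without terminal vertices, together
with the set `V0` of positions of Player 0.  The positions of Player 1 are `V0ᶜ`. -/
structure Arena (V : Type u) where
  V0 : Set V
  E : V → V → Prop
  finite : Finite V
  exists_succ : ∀ v, ∃ v', E v v'

variable {V : Type u}

/-- The word `ρ 0, …, ρ (n - 1)`. -/
def pref (ρ : ℕ → V) (n : ℕ) : List V := (List.range n).map ρ

/-- The set of vertices that occur infinitely often. -/
def infSet (ρ : ℕ → V) : Set V := {v | ∀ n, ∃ m, n ≤ m ∧ ρ m = v}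

namespace Arena

/-- Infinite plays. -/
def IsPlay (A : Arena V) (ρ : ℕ → V) : Prop := ∀ n, A.E (ρ n) (ρ (n + 1))

/-- Play prefixes: non-empty finite words that follow the edges. -/
def IsPlayPrefix (A : Arena V) (w : List V) : Prop := w ≠ [] ∧ w.IsChain A.E

/-- A loop: a (non-empty) strongly connected set of vertices.  Paths have at least one edge, so
that a singleton is a loop exactly if its vertex has a self-loop. -/
def IsLoop (A : Arena V) (C : Set V) : Prop :=
  C.Nonempty ∧
    ∀ v ∈ C, ∀ v' ∈ C, Relation.TransGen (fun a b => a ∈ C ∧ b ∈ C ∧ A.E a b) v v'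

end Arena

/-- A strategy for Player 0; `move w v` is the value at the word `wv`.  Only the values with
`v ∈ V0` matter. -/
structure Strategy (A : Arena V) where
  move : List V → V → V
  edge : ∀ w v, v ∈ A.V0 → A.E v (move w v)

/-- The plays that start in `v` and are consistent with a strategy. -/
def Strategy.Beh {A : Arena V} (σ : Strategy A) (v : V) : Set (ℕ → V) :=
  {ρ | A.IsPlay ρ ∧ ρ 0 = v ∧ ∀ n, ρ n ∈ A.V0 → ρ (n + 1) = σ.move (pref ρ n) (ρ n)}

/-- The winning region of Player 0 in the game with arena `A` and winning plays `Win`. -/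
def winningRegion (A : Arena V) (Win : Set (ℕ → V)) : Set V :=
  {v | ∃ σ : Strategy A, σ.Beh v ⊆ Win}

/-- A multi-strategy for Player 0; `move w v` is the value at the word `wv`, a non-empty set of
successors of `v`.  Only the values with `v ∈ V0` matter. -/
structure MultiStrategy (A : Arena V) where
  move : List V → V → Set V
  nonempty : ∀ w v, v ∈ A.V0 → (move w v).Nonempty
  edge : ∀ w v, v ∈ A.V0 → ∀ v' ∈ move w v, A.E v v'

/-- The plays that start in `v` and are consistent with a multi-strategy. -/
def MultiStrategy.Beh {A : Arena V} (σ : MultiStrategy A) (v : V) : Set (ℕ → V) :=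
  {ρ | A.IsPlay ρ ∧ ρ 0 = v ∧ ∀ n, ρ n ∈ A.V0 → ρ (n + 1) ∈ σ.move (pref ρ n) (ρ n)}

/-! ## Finite memory -/

/-- A memory structure with the finite set `M` of memory states. -/
structure MemoryStructure (V : Type*) (M : Type*) where
  finite : Finite M
  init : V → M
  update : M → V → M

/-- The extension of the update function to non-empty words: `updateStar w v` is its value at
the word `wv`. -/
def MemoryStructure.updateStar {M : Type*} (mem : MemoryStructure V M) : List V → V → M
  | [], v => mem.init v
  | a :: w, v => (w ++ [v]).foldl mem.update (mem.init a)

/-- A (set-valued) next-move function for Player 0. -/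
structure NextMove (A : Arena V) (M : Type*) where
  next : V → M → Set V
  nonempty : ∀ v m, v ∈ A.V0 → (next v m).Nonempty
  edge : ∀ v m, v ∈ A.V0 → ∀ v' ∈ next v m, A.E v v'

/-- The multi-strategy implemented by a memory structure and a next-move function. -/
def MemoryStructure.implement {A : Arena V} {M : Type*} (mem : MemoryStructure V M)
    (nxt : NextMove A M) : MultiStrategy A where
  move w v := nxt.next v (mem.updateStar w v)
  nonempty _ _ hv := nxt.nonempty _ _ hv
  edge _ _ hv := nxt.edge _ _ hv

/-! ## Scores and accumulators -/

open Classical in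
/-- The effect of one further letter `v` on the pair (score, accumulator) of the set `F`. -/
noncomputable def scoreStep (F : Set V) (p : ℕ × Set V) (v : V) : ℕ × Set V :=
  if v ∉ F then (0, ∅)
  else if p.2 = F \ {v} then (p.1 + 1, ∅)
  else (p.1, p.2 ∪ {v})

/-- Score and accumulator of `F` after a word.  Starting from `(0, ∅)` on the empty word gives
the right values on one-letter words, see `scoreAcc_singleton_self` and `scoreAcc_singleton`. -/
noncomputable def scoreAcc (F : Set V) (w : List V) : ℕ × Set V :=
  w.foldl (scoreStep F) (0, ∅)

noncomputable def score (F : Set V) (w : List V) : ℕ := (scoreAcc F w).1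

noncomputable def acc (F : Set V) (w : List V) : Set V := (scoreAcc F w).2

theorem scoreAcc_singleton_self (v : V) : scoreAcc {v} [v] = (1, ∅) := by
  simp [scoreAcc, scoreStep]

theorem scoreAcc_singleton (F : Set V) (v : V) (h : F ≠ {v}) :
    scoreAcc F [v] = (0, F ∩ {v}) := by
  by_cases hv : v ∈ F
  · have h1 : ¬ (∅ : Set V) = F \ {v} := by
      intro h2
      apply h
      ext x
      constructor
      · intro hx
        by_contra hxv
        have : x ∈ F \ {v} := ⟨hx, hxv⟩
        rw [← h2] at this
        exact this
      · rintro rfl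
        exact hv
    simp [scoreAcc, scoreStep, hv, h1]
  · simp [scoreAcc, scoreStep, hv]

theorem scoreAcc_snoc (F : Set V) (w : List V) (v : V) :
    scoreAcc F (w ++ [v]) = scoreStep F (scoreAcc F w) v := by
  simp [scoreAcc]

theorem score_snoc_le (F : Set V) (w : List V) (v : V) :
    score F (w ++ [v]) ≤ score F w + 1 := by
  unfold score
  rw [scoreAcc_snoc]
  unfold scoreStep
  split_ifs <;> simp

/-- The maximal score over the sets in `𝓕` and the prefixes of a finite word. -/
noncomputable def maxScoreWord (𝓕 : Set (Set V)) (w : List V) : ℕ∞ :=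
  ⨆ F ∈ 𝓕, ⨆ w' : List V, ⨆ _ : w' <+: w, (score F w' : ℕ∞)

/-- The maximal score over the sets in `𝓕` and the prefixes of an infinite word. -/
noncomputable def maxScore (𝓕 : Set (Set V)) (ρ : ℕ → V) : ℕ∞ :=
  ⨆ F ∈ 𝓕, ⨆ n : ℕ, (score F (pref ρ n) : ℕ∞)

theorem score_le_maxScoreWord {𝓕 : Set (Set V)} {F : Set V} (hF : F ∈ 𝓕) {w' w : List V}
    (h : w' <+: w) : (score F w' : ℕ∞) ≤ maxScoreWord 𝓕 w :=
  le_iSup₂_of_le F hF (le_iSup₂_of_le w' h le_rfl)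

theorem maxScoreWord_snoc_le (𝓕 : Set (Set V)) (w : List V) (v : V) :
    maxScoreWord 𝓕 (w ++ [v]) ≤ maxScoreWord 𝓕 w + 1 := by
  refine iSup₂_le fun F hF => iSup₂_le fun w' h => ?_
  rcases List.prefix_concat_iff.1 h with rfl | h
  · calc (score F (w ++ [v]) : ℕ∞) ≤ ((score F w + 1 : ℕ) : ℕ∞) := by
          exact_mod_cast score_snoc_le F w v
      _ = (score F w : ℕ∞) + 1 := by push_cast; rfl
      _ ≤ _ := by
          gcongr
          exact score_le_maxScoreWord hF (List.prefix_refl w)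
  · exact (score_le_maxScoreWord hF h).trans le_self_add

/-- The score-based preorder on words. -/
def Smaller (𝓕 : Set (Set V)) (w w' : List V) : Prop :=
  w.getLast? = w'.getLast? ∧ ∀ F ∈ 𝓕,
    score F w < score F w' ∨ (score F w = score F w' ∧ acc F w ⊆ acc F w')

/-- The induced equivalence of words. -/
def ScoreEquiv (𝓕 : Set (Set V)) (w w' : List V) : Prop := Smaller 𝓕 w w' ∧ Smaller 𝓕 w' w

theorem Smaller.refl (𝓕 : Set (Set V)) (w : List V) : Smaller 𝓕 w w :=
  ⟨rfl, fun _ _ => Or.inr ⟨rfl, subset_rfl⟩⟩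

theorem Smaller.trans {𝓕 : Set (Set V)} {w w' w'' : List V} (h : Smaller 𝓕 w w')
    (h' : Smaller 𝓕 w' w'') : Smaller 𝓕 w w'' := by
  refine ⟨h.1.trans h'.1, fun F hF => ?_⟩
  rcases h.2 F hF with h1 | ⟨h1, h2⟩ <;> rcases h'.2 F hF with h3 | ⟨h3, h4⟩
  · exact Or.inl (h1.trans h3)
  · exact Or.inl (h3 ▸ h1)
  · exact Or.inl (h1 ▸ h3)
  · exact Or.inr ⟨h1.trans h3, h2.trans h4⟩

theorem ScoreEquiv.eq {𝓕 : Set (Set V)} {w w' : List V} (h : ScoreEquiv 𝓕 w w') :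
    w.getLast? = w'.getLast? ∧ ∀ F ∈ 𝓕, score F w = score F w' ∧ acc F w = acc F w' := by
  refine ⟨h.1.1, fun F hF => ?_⟩
  rcases h.1.2 F hF with h1 | ⟨h1, h2⟩ <;> rcases h.2.2 F hF with h3 | ⟨h3, h4⟩
  · omega
  · omega
  · omega
  · exact ⟨h1, h2.antisymm h4⟩

/-! ## Safety games and Muller games -/

/-- A safety game: Player 0 wins the plays that stay in `F`. -/
structure SafetyGame (V : Type u) where
  arena : Arena V
  F : Set V

namespace SafetyGame

def Win (S : SafetyGame V) : Set (ℕ → V) := {ρ | Set.range ρ ⊆ S.F}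

/-- The winning region of Player 0. -/
def W0 (S : SafetyGame V) : Set V := winningRegion S.arena S.Win

end SafetyGame

/-- A Muller game: Player 0 wins the plays whose infinity set is in `𝓕0`. -/
structure MullerGame (V : Type u) where
  arena : Arena V
  𝓕0 : Set (Set V)
  isLoop : ∀ C ∈ 𝓕0, arena.IsLoop C

namespace MullerGame

/-- The loops that are not in `𝓕0`. -/
def 𝓕1 (G : MullerGame V) : Set (Set V) := {C | G.arena.IsLoop C ∧ C ∉ G.𝓕0}

def Win (G : MullerGame V) : Set (ℕ → V) := {ρ | infSet ρ ∈ G.𝓕0}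

/-- The winning region of Player 0. -/
def W0 (G : MullerGame V) : Set V := winningRegion G.arena G.Win

/-! ## The safety game of a Muller game -/

/-- Play prefixes in which the scores of Player 1 are at most 2. -/
def playsLT (G : MullerGame V) : Set (List V) :=
  {w | G.arena.IsPlayPrefix w ∧ maxScoreWord G.𝓕1 w < 3}

/-- Play prefixes in which Player 1 just reached a score of 3. -/
def playsEQ (G : MullerGame V) : Set (List V) :=
  {w | ∃ u v, w = u ++ [v] ∧ u ≠ [] ∧ G.arena.IsPlayPrefix w ∧
    maxScoreWord G.𝓕1 u ≤ 2 ∧ maxScoreWord G.𝓕1 w = 3}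

def playsLE (G : MullerGame V) : Set (List V) := G.playsLT ∪ G.playsEQ

instance setoid (G : MullerGame V) : Setoid G.playsLE where
  r w w' := ScoreEquiv G.𝓕1 w.1 w'.1
  iseqv :=
    { refl := fun _ => ⟨Smaller.refl _ _, Smaller.refl _ _⟩
      symm := fun h => ⟨h.2, h.1⟩
      trans := fun h h' => ⟨h.1.trans h'.1, h'.2.trans h.2⟩ }

/-- The vertices of the safety game. -/
def VS (G : MullerGame V) : Type u := Quotient G.setoid

/-- The equivalence class of a play prefix. -/
def cls (G : MullerGame V) (w : G.playsLE) : G.VS := Quotient.mk G.setoid w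

/-- The classes of the play prefixes ending in a position of Player 0. -/
def V0S (G : MullerGame V) : Set G.VS :=
  {q | ∃ w : G.playsLE, q = G.cls w ∧ ∃ v ∈ G.arena.V0, w.1.getLast? = some v}

/-- The safe vertices: the classes of the play prefixes in which Player 1's scores are at
most 2. -/
def safe (G : MullerGame V) : Set G.VS :=
  {q | ∃ w : G.playsLE, q = G.cls w ∧ w.1 ∈ G.playsLT}

/-- The edges: from `[w]` to `[wv]` for `w` in `playsLT` and every successor `v` of the last
vertex of `w`.  The unsafe vertices would have no successors; they get a self-loop, so that the
graph is an arena.  A play that visits them is lost for Player 0 anyway. -/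
def ES (G : MullerGame V) (q q' : G.VS) : Prop :=
  (∃ w w' : G.playsLE, q = G.cls w ∧ q' = G.cls w' ∧ w.1 ∈ G.playsLT ∧
    ∃ a v, w.1.getLast? = some a ∧ G.arena.E a v ∧ w'.1 = w.1 ++ [v]) ∨
  (q ∉ G.safe ∧ q' = q)

theorem snoc_mem_playsLE (G : MullerGame V) {w : List V} (hw : w ∈ G.playsLT) {a v : V}
    (ha : w.getLast? = some a) (hv : G.arena.E a v) : w ++ [v] ∈ G.playsLE := by
  have hp : G.arena.IsPlayPrefix (w ++ [v]) := by
    refine ⟨by simp, ?_⟩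
    rw [List.isChain_append]
    refine ⟨hw.1.2, by simp, ?_⟩
    intro x hx y hy
    simp only [ha, Option.mem_some_iff, List.head?_cons] at hx hy
    subst hx hy
    exact hv
  have h2 : maxScoreWord G.𝓕1 w ≤ 2 := Order.le_of_lt_add_one (by
    have := hw.2
    norm_num
    exact this)
  have h3 : maxScoreWord G.𝓕1 (w ++ [v]) ≤ 3 := by
    refine (maxScoreWord_snoc_le _ _ _).trans ?_
    calc maxScoreWord G.𝓕1 w + 1 ≤ 2 + 1 := by gcongr
      _ = 3 := by norm_num
  rcases h3.lt_or_eq with h | h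
  · exact Or.inl ⟨hp, h⟩
  · exact Or.inr ⟨w, v, rfl, hw.1.1, hp, h2, h⟩

theorem score_le_three (G : MullerGame V) (w : G.playsLE) {F : Set V} (hF : F ∈ G.𝓕1) :
    score F w.1 ≤ 3 := by
  have h : maxScoreWord G.𝓕1 w.1 ≤ 3 := by
    rcases w.2 with h | ⟨_, _, _, _, _, _, h⟩
    · exact h.2.le
    · exact h.le
  exact_mod_cast (score_le_maxScoreWord hF (List.prefix_refl w.1)).trans h

theorem finite_VS (G : MullerGame V) : Finite G.VS := by
  have := G.arena.finite
  let f : G.playsLE → Option V × (G.𝓕1 → Fin 4 × Set V) := fun w =>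
    (w.1.getLast?, fun F => (⟨score F.1 w.1, Nat.lt_succ_of_le (G.score_le_three w F.2)⟩,
      acc F.1 w.1))
  have hf : ∀ w w' : G.playsLE, G.setoid w w' → f w = f w' := by
    intro w w' h
    have h' := ScoreEquiv.eq h
    refine Prod.ext h'.1 (funext fun F => Prod.ext (Fin.ext (h'.2 F.1 F.2).1) (h'.2 F.1 F.2).2)
  refine Finite.of_injective (Quotient.lift f hf : G.VS → _) ?_
  intro q q'
  induction q using Quotient.inductionOn with | _ w
  induction q' using Quotient.inductionOn with | _ w'
  intro h
  have h1 : f w = f w' := h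
  have hl : w.1.getLast? = w'.1.getLast? := congrArg Prod.fst h1
  have hs : ∀ F ∈ G.𝓕1, score F w.1 = score F w'.1 ∧ acc F w.1 = acc F w'.1 := fun F hF =>
    ⟨congrArg (fun p => ((p.2 ⟨F, hF⟩).1 : ℕ)) h1, congrArg (fun p => (p.2 ⟨F, hF⟩).2) h1⟩
  exact Quotient.sound
    ⟨⟨hl, fun F hF => Or.inr ⟨(hs F hF).1, (hs F hF).2.subset⟩⟩,
      ⟨hl.symm, fun F hF => Or.inr ⟨(hs F hF).1.symm, (hs F hF).2.symm.subset⟩⟩⟩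

/-- The safety game of a Muller game, which keeps track of the scores of Player 1 up to 3. -/
def safetyGame (G : MullerGame V) : SafetyGame G.VS where
  arena :=
    { V0 := G.V0S
      E := G.ES
      finite := G.finite_VS
      exists_succ := by
        intro q
        by_cases hq : q ∈ G.safe
        · obtain ⟨w, rfl, hw⟩ := hq
          obtain ⟨a, ha⟩ : ∃ a, w.1.getLast? = some a :=
            ⟨_, List.getLast?_eq_some_getLast hw.1.1⟩
          obtain ⟨v, hv⟩ := G.arena.exists_succ a
          exact ⟨_, Or.inl ⟨w, ⟨w.1 ++ [v], G.snoc_mem_playsLE hw ha hv⟩, rfl, rfl, hw, a, v,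
            ha, hv, rfl⟩⟩
        · exact ⟨q, Or.inr ⟨hq, rfl⟩⟩ }
  F := G.safe

/-! ## Permissive multi-strategies -/

/-- A multi-strategy for Player 0 is permissive if it wins from every vertex of the winning
region of Player 0 and contains, from every vertex, the behaviour of every multi-strategy that
bounds the scores of Player 1 by 2 from this vertex. -/
def IsPermissive (G : MullerGame V) (σ' : MultiStrategy G.arena) : Prop :=
  (∀ v ∈ G.W0, σ'.Beh v ⊆ G.Win) ∧
  ∀ (σ : MultiStrategy G.arena) (v : V),
    (∀ ρ ∈ σ.Beh v, maxScore G.𝓕1 ρ ≤ 2) → σ.Beh v ⊆ σ'.Beh v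

end MullerGame

end MullerPermissive

namespace MullerPermissive

universe u

variable {V : Type u}

/-! ## One step of scores and accumulators -/

/-! The memory state is the class of the history in the safety game, and Player 0 may make every
move that keeps this class in the winning region. From a vertex whose one-letter word is safe, the
allowed plays are then exactly those all of whose prefixes are safe (`mem_next_iff`). Such plays are
won: the score of the infinity set, which is a loop, tends to infinity along a play
(`exists_le_score_infSet`), while safe prefixes bound the scores of Player 1 by 2. They include
every behaviour with scores at most 2, because the tree of such a behaviour projects to a controlled
set of safe classes (`safe_of_tree`).

The hard part is that every `v` in the Muller winning region gives a safe word `[v]`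
(`safe_of_mem_W0`), that is, that a winning Player 0 can also keep all scores at most 2. This is
`bounding`, an induction on sub-arenas `X` in which Player 0 wins everywhere, starting from fresh
scores. The tool is a phase in which she attracts the play to a set `B`, using the induction
hypothesis outside the attractor (`Approach`).

If `X` is not in `𝓕0`, she also wins in some proper trap `U` for Player 1 (`exists_trap`); she
attracts to `U` and then stays there, playing by induction. If `X` is in `𝓕0`, every set to be
bounded is proper in `X`; she repeatedly picks a bad set `C` containing all current progress and
attracts to `X \ C`, where the scores are fresh again. -/

theorem score_snoc_of_notMem {F : Set V} {v : V} (h : v ∉ F) (w : List V) :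
    score F (w ++ [v]) = 0 ∧ acc F (w ++ [v]) = ∅ := by
  simp [score, acc, scoreAcc_snoc, scoreStep, h]

theorem score_snoc_of_eq {F : Set V} {v : V} (h : v ∈ F) {w : List V} (ha : acc F w = F \ {v}) :
    score F (w ++ [v]) = score F w + 1 ∧ acc F (w ++ [v]) = ∅ := by
  unfold acc at ha
  simp [score, acc, scoreAcc_snoc, scoreStep, h, ha]

theorem score_snoc_of_ne {F : Set V} {v : V} (h : v ∈ F) {w : List V} (ha : acc F w ≠ F \ {v}) :
    score F (w ++ [v]) = score F w ∧ acc F (w ++ [v]) = acc F w ∪ {v} := by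
  unfold acc at ha
  simp only [score, acc, scoreAcc_snoc, scoreStep, h, ha, not_true, if_false, and_self]

theorem acc_subset (F : Set V) (w : List V) : acc F w ⊆ F := by
  induction w using List.reverseRecOn with
  | nil => simp [acc, scoreAcc]
  | append_singleton w v ih =>
    by_cases hv : v ∈ F
    · by_cases ha : acc F w = F \ {v}
      · rw [(score_snoc_of_eq hv ha).2]; exact Set.empty_subset _
      · rw [(score_snoc_of_ne hv ha).2]
        exact Set.union_subset ih (by simpa using hv)
    · rw [(score_snoc_of_notMem hv w).2]; exact Set.empty_subset _

/-- The letter that would complete the accumulator resets it to the empty set instead. -/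
theorem acc_ne {F : Set V} (hF : F.Nonempty) (w : List V) : acc F w ≠ F := by
  induction w using List.reverseRecOn with
  | nil => simpa [acc, scoreAcc] using hF.ne_empty.symm
  | append_singleton w v ih =>
    by_cases hv : v ∈ F
    · by_cases ha : acc F w = F \ {v}
      · rw [(score_snoc_of_eq hv ha).2]; exact hF.ne_empty.symm
      · rw [(score_snoc_of_ne hv ha).2]
        intro h
        by_cases hva : v ∈ acc F w
        · exact ih (by rwa [Set.union_eq_self_of_subset_right (by simpa using hva)] at h)
        · apply ha
          have h' := congrArg (· \ {v}) h
          simpa only [Set.union_sdiff_right, Set.sdiff_singleton_eq_self hva] using h'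
    · rw [(score_snoc_of_notMem hv w).2]; exact hF.ne_empty.symm

theorem acc_nil (F : Set V) : acc F [] = ∅ := rfl

/-- Accumulators are the sets of letters of suffixes. -/
theorem exists_suffix_acc (F : Set V) (w : List V) :
    ∃ s, s <:+ w ∧ acc F w = {a | a ∈ s} := by
  induction w using List.reverseRecOn with
  | nil => exact ⟨[], List.suffix_refl _, by simp [acc_nil]⟩
  | append_singleton w v ih =>
    obtain ⟨s, hs, h⟩ := ih
    by_cases hv : v ∈ F
    · by_cases ha : acc F w = F \ {v}
      · exact ⟨[], List.nil_suffix, by simp [(score_snoc_of_eq hv ha).2]⟩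
      · refine ⟨s ++ [v], ?_, ?_⟩
        · obtain ⟨t, rfl⟩ := hs; exact ⟨t, by simp⟩
        · rw [(score_snoc_of_ne hv ha).2, h]; ext; simp [or_comm]
    · exact ⟨[], List.nil_suffix, by simp [(score_snoc_of_notMem hv w).2]⟩

/-- Sets with a positive score are the sets of letters of suffixes. -/
theorem exists_suffix_of_score_ne_zero {F : Set V} {w : List V} (h0 : score F w ≠ 0) :
    ∃ s, s <:+ w ∧ F = {a | a ∈ s} := by
  induction w using List.reverseRecOn with
  | nil => exact absurd rfl h0
  | append_singleton w v ih =>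
    by_cases hv : v ∈ F
    · by_cases ha : acc F w = F \ {v}
      · obtain ⟨s, ⟨t, rfl⟩, h⟩ := exists_suffix_acc F w
        refine ⟨s ++ [v], ⟨t, by simp⟩, ?_⟩
        rw [h] at ha
        ext a
        have := Set.ext_iff.1 ha a
        simp only [Set.mem_ofPred_eq, Set.mem_sdiff, Set.mem_singleton_iff, List.mem_append,
          List.mem_singleton] at this ⊢
        by_cases hav : a = v
        · simp [hav, hv]
        · simp [this, hav]
      · rw [(score_snoc_of_ne hv ha).1] at h0
        obtain ⟨s, ⟨t, rfl⟩, h⟩ := ih h0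
        refine ⟨s ++ [v], ⟨t, by simp⟩, ?_⟩
        ext a
        have := Set.ext_iff.1 h a
        simp only [Set.mem_ofPred_eq, List.mem_append, List.mem_singleton] at this ⊢
        rw [← this]
        constructor
        · exact Or.inl
        · rintro (h | rfl)
          exacts [h, hv]
    · exact absurd (score_snoc_of_notMem hv w).1 h0

/-! ## Prefixes of infinite words -/

theorem pref_succ (ρ : ℕ → V) (n : ℕ) : pref ρ (n + 1) = pref ρ n ++ [ρ n] := by
  simp [pref, List.range_succ]

theorem pref_zero (ρ : ℕ → V) : pref ρ 0 = [] := rfl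

theorem length_pref (ρ : ℕ → V) (n : ℕ) : (pref ρ n).length = n := by simp [pref]

theorem pref_isPrefix (ρ : ℕ → V) {m n : ℕ} (h : m ≤ n) : pref ρ m <+: pref ρ n := by
  induction n, h using Nat.le_induction with
  | base => exact List.prefix_refl _
  | succ n _ ih => exact ih.trans (by rw [pref_succ]; exact List.prefix_append _ _)

/-- A relation on pointed words in which every element can be prolonged has an infinite branch
through each element. -/
theorem exists_branch {T : List V → V → Prop} (h : ∀ w x, T w x → ∃ y, T (w ++ [x]) y)
    {w₀ : List V} {x₀ : V} (h₀ : T w₀ x₀) :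
    ∃ ρ : ℕ → V, pref ρ w₀.length = w₀ ∧ ρ w₀.length = x₀ ∧
      ∀ n, w₀.length ≤ n → T (pref ρ n) (ρ n) := by
  choose! f hf using h
  let st : ℕ → List V × V := fun n => (fun p => (p.1 ++ [p.2], f p.1 p.2))^[n] (w₀, x₀)
  have hs : ∀ n, st (n + 1) = ((st n).1 ++ [(st n).2], f (st n).1 (st n).2) := fun n =>
    Function.iterate_succ_apply' _ _ _
  have hT : ∀ n, T (st n).1 (st n).2 := by
    intro n
    induction n with
    | zero => exact h₀
    | succ n ih => rw [hs]; exact hf _ _ ih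
  -- The branch spells `w₀` and then the marked letters of the iterates, so `st k` is the pointed
  -- word at position `w₀.length + k`.
  let ρ : ℕ → V := fun n => if h : n < w₀.length then w₀[n] else (st (n - w₀.length)).2
  have hp : pref ρ w₀.length = w₀ := by
    apply List.ext_getElem (by simp [length_pref])
    intro i h1 h2
    simp [pref, ρ, h2]
  have hρ : ∀ k, ρ (w₀.length + k) = (st k).2 := fun k => by simp [ρ]
  have hk : ∀ k, pref ρ (w₀.length + k) = (st k).1 := by
    intro k
    induction k with
    | zero => exact hp
    | succ k ih => rw [← add_assoc, pref_succ, ih, hρ, hs]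
  refine ⟨ρ, hp, hρ 0, fun n hn => ?_⟩
  obtain ⟨k, rfl⟩ := Nat.exists_eq_add_of_le hn
  rw [hk, hρ]
  exact hT k

/-! ## The infinity set of a play -/

theorem exists_forall_mem_infSet [Finite V] (ρ : ℕ → V) : ∃ N, ∀ n, N ≤ n → ρ n ∈ infSet ρ := by
  have : ∀ v : V, ∃ N, v ∉ infSet ρ → ∀ n, N ≤ n → ρ n ≠ v := by
    intro v
    by_cases hv : v ∈ infSet ρ
    · exact ⟨0, fun h => absurd hv h⟩
    · simp only [infSet, Set.mem_ofPred_eq, not_forall, not_exists, not_and] at hv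
      obtain ⟨N, hN⟩ := hv
      exact ⟨N, fun _ => hN⟩
  choose f hf using this
  obtain ⟨N, hN⟩ := (Set.finite_range f).bddAbove
  refine ⟨N, fun n hn => ?_⟩
  by_contra h
  exact hf _ h n ((hN ⟨_, rfl⟩).trans hn) rfl

theorem Arena.IsPlay.isLoop_infSet {A : Arena V} {ρ : ℕ → V} (h : A.IsPlay ρ) :
    A.IsLoop (infSet ρ) := by
  have := A.finite
  obtain ⟨N, hN⟩ := exists_forall_mem_infSet ρ
  refine ⟨⟨_, hN N le_rfl⟩, fun v hv v' hv' => ?_⟩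
  obtain ⟨n, hn, rfl⟩ := hv N
  obtain ⟨m, hm, rfl⟩ := hv' (n + 1)
  induction m, hm using Nat.le_induction with
  | base => exact .single ⟨hN _ hn, hN _ (by omega), h n⟩
  | succ m hm ih =>
    exact (ih (hN m (by omega))).tail ⟨hN m (by omega), hN _ (by omega), h m⟩

/-- Once only vertices of the infinity set occur, its score never drops. Were it to stay at `k`, the
accumulator would never be reset and would collect the whole set, against `acc_ne`. -/
theorem exists_le_score_infSet [Finite V] (ρ : ℕ → V) (k : ℕ) :
    ∃ N, ∀ n, N ≤ n → k ≤ score (infSet ρ) (pref ρ n) := by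
  obtain ⟨N, hN⟩ := exists_forall_mem_infSet ρ
  set F := infSet ρ with hF
  have hne : F.Nonempty := ⟨_, hN N le_rfl⟩
  have hmono : ∀ m n, N ≤ m → m ≤ n → score F (pref ρ m) ≤ score F (pref ρ n) := by
    intro m n hm hmn
    induction n, hmn using Nat.le_induction with
    | base => exact le_rfl
    | succ n hn ih =>
      refine ih.trans ?_
      rw [pref_succ]
      by_cases ha : acc F (pref ρ n) = F \ {ρ n}
      · rw [(score_snoc_of_eq (hN n (by omega)) ha).1]; omega
      · rw [(score_snoc_of_ne (hN n (by omega)) ha).1]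
  induction k with
  | zero => exact ⟨0, fun _ _ => Nat.zero_le _⟩
  | succ k ih =>
    obtain ⟨M, hM⟩ := ih
    set m := max M N
    by_contra hcon
    push Not at hcon
    have hlt : ∀ n, m ≤ n → score F (pref ρ n) = k := by
      intro n hn
      obtain ⟨n', h1, h2⟩ := hcon n
      have := hmono n n' (by omega) h1
      have := hM n (by omega)
      omega
    have hacc : ∀ n, m ≤ n → ∀ i, m ≤ i → i < n → ρ i ∈ acc F (pref ρ n) := by
      intro n hn
      induction n, hn using Nat.le_induction with
      | base => intro i h1 h2; omega
      | succ n hn ih =>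
        intro i h1 h2
        rw [pref_succ]
        by_cases ha : acc F (pref ρ n) = F \ {ρ n}
        · have h3 := (score_snoc_of_eq (hN n (by omega)) ha).1
          rw [← pref_succ, hlt _ hn, hlt _ (by omega)] at h3
          omega
        · rw [(score_snoc_of_ne (hN n (by omega)) ha).2]
          rcases Nat.lt_succ_iff_lt_or_eq.1 h2 with h | rfl
          · exact Or.inl (ih i h1 h)
          · exact Or.inr rfl
    have : ∀ v : V, ∃ i, v ∈ F → m ≤ i ∧ ρ i = v := by
      intro v
      by_cases hv : v ∈ F
      · obtain ⟨i, hi⟩ := hv m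
        exact ⟨i, fun _ => hi⟩
      · exact ⟨0, fun h => absurd h hv⟩
    choose g hg using this
    obtain ⟨K, hK⟩ := (Set.finite_range g).bddAbove
    refine acc_ne hne (pref ρ (max m (K + 1))) ((acc_subset _ _).antisymm fun v hv => ?_)
    have h1 : g v ≤ K := hK ⟨v, rfl⟩
    have h2 := hacc (max m (K + 1)) (le_max_left _ _) (g v) (hg v hv).1 (by omega)
    rwa [(hg v hv).2] at h2

/-! ## Controllable predecessors, attractors and strategy trees -/

/-- In `x`, Player 0 can ensure that the next vertex satisfies `P` if the play stays in `X`. -/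
def Arena.CPre (A : Arena V) (X : Set V) (P : V → Prop) (x : V) : Prop :=
  (x ∈ A.V0 → ∃ y ∈ X, A.E x y ∧ P y) ∧ (x ∉ A.V0 → ∀ y ∈ X, A.E x y → P y)

theorem Arena.CPre.mono {A : Arena V} {X : Set V} {P Q : V → Prop} {x : V} (h : A.CPre X P x)
    (hPQ : ∀ y ∈ X, A.E x y → P y → Q y) : A.CPre X Q x :=
  ⟨fun hx => let ⟨y, hy, he, hp⟩ := h.1 hx; ⟨y, hy, he, hPQ y hy he hp⟩,
    fun hx y hy he => hPQ y hy he (h.2 hx y hy he)⟩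

/-- `X` induces a sub-arena. -/
def Arena.IsSub (A : Arena V) (X : Set V) : Prop := ∀ x ∈ X, ∃ y ∈ X, A.E x y

/-- The stages of the attractor of `B` for Player 0 in `X`. -/
def Arena.attr (A : Arena V) (X B : Set V) : ℕ → Set V
  | 0 => B
  | n + 1 => A.attr X B n ∪ {x | x ∈ X ∧ A.CPre X (· ∈ A.attr X B n) x}

theorem Arena.attr_mono (A : Arena V) (X B : Set V) : Monotone (A.attr X B) :=
  monotone_nat_of_le_succ fun _ => Set.subset_union_left

theorem Arena.attr_subset (A : Arena V) {X B : Set V} (h : B ⊆ X) (n : ℕ) : A.attr X B n ⊆ X := by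
  induction n with
  | zero => exact h
  | succ n ih => exact Set.union_subset ih fun x hx => hx.1

/-- The complement in `X` of the attractor of `B`. -/
def Arena.rest (A : Arena V) (X B : Set V) : Set V := {x | x ∈ X ∧ ∀ n, x ∉ A.attr X B n}

theorem Arena.rest_subset (A : Arena V) (X B : Set V) : A.rest X B ⊆ X := fun _ h => h.1

theorem Arena.mem_rest_of_edge {A : Arena V} {X B : Set V} {x y : V} (hx : x ∈ A.rest X B)
    (h0 : x ∈ A.V0) (hy : y ∈ X) (he : A.E x y) : y ∈ A.rest X B :=
  ⟨hy, fun n hn => hx.2 (n + 1) (Or.inr ⟨hx.1, fun _ => ⟨y, hy, he, hn⟩, fun h => absurd h0 h⟩)⟩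

/-- Player 0 has no edge from the rest into the attractor. If all successors in `X` of a Player 1
vertex were attracted, then by finiteness a single stage would contain them, and the vertex would
belong to the next stage. -/
theorem Arena.IsSub.rest {A : Arena V} {X : Set V} (h : A.IsSub X) (B : Set V) :
    A.IsSub (A.rest X B) := by
  intro x hx
  by_cases h0 : x ∈ A.V0
  · obtain ⟨y, hy, he⟩ := h x hx.1
    exact ⟨y, mem_rest_of_edge hx h0 hy he, he⟩
  · by_contra hcon
    push Not at hcon
    have : ∀ y, ∃ n, y ∈ X → A.E x y → y ∈ A.attr X B n := by
      intro y
      by_cases hy : y ∈ X ∧ A.E x y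
      · have := fun h' => hcon y h' hy.2
        simp only [Arena.rest, Set.mem_ofPred_eq, hy.1, true_and, not_forall, not_not, imp_false]
          at this
        exact this.imp fun n hn _ _ => hn
      · exact ⟨0, fun h1 h2 => absurd ⟨h1, h2⟩ hy⟩
    choose f hf using this
    have := A.finite
    obtain ⟨N, hN⟩ := (Set.finite_range f).bddAbove
    refine hx.2 (N + 1) (Or.inr ⟨hx.1, fun h => absurd h h0, fun _ y hy he => ?_⟩)
    exact A.attr_mono X B (hN ⟨y, rfl⟩) (hf y hy he)

/-- A strategy for Player 0 in the sub-arena `X`, given by the set of words `w ++ [x]` that are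
consistent with it. -/
def Arena.IsTree (A : Arena V) (X : Set V) (T : List V → V → Prop) : Prop :=
  ∀ w x, T w x → x ∈ X ∧ A.CPre X (T (w ++ [x])) x

def PrefixClosed (T : List V → V → Prop) : Prop := ∀ w x y, T (w ++ [x]) y → T w x

theorem PrefixClosed.of_append {T : List V → V → Prop} (h : PrefixClosed T) {w : List V} {x : V}
    (u : List V) {y : V} (hT : T (w ++ x :: u) y) : T w x := by
  induction u using List.reverseRecOn generalizing y with
  | nil => exact h _ _ _ hT
  | append_singleton u a ih =>
    refine ih (y := a) (h _ _ y ?_)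
    simpa using hT

theorem Arena.IsTree.exists_next {A : Arena V} {X : Set V} {T : List V → V → Prop}
    (hT : A.IsTree X T) (hX : A.IsSub X) {w : List V} {x : V} (h : T w x) :
    ∃ y ∈ X, A.E x y ∧ T (w ++ [x]) y := by
  obtain ⟨hx, h0, h1⟩ := hT w x h
  by_cases hx0 : x ∈ A.V0
  · exact h0 hx0
  · obtain ⟨y, hy, he⟩ := hX x hx
    exact ⟨y, hy, he, h1 hx0 y hy he⟩

theorem infSet_shift (ρ : ℕ → V) (k : ℕ) : infSet (fun n => ρ (k + n)) = infSet ρ := by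
  ext v
  constructor
  · intro h n
    obtain ⟨m, hm, rfl⟩ := h n
    exact ⟨k + m, by omega, rfl⟩
  · intro h n
    obtain ⟨m, hm, rfl⟩ := h (k + n)
    exact ⟨m - k, by omega, congrArg ρ (by omega)⟩

theorem PrefixClosed.branch {T : List V → V → Prop} (h : PrefixClosed T) {ρ : ℕ → V} {N : ℕ}
    (hρ : ∀ n, N ≤ n → T (pref ρ n) (ρ n)) (n : ℕ) : T (pref ρ n) (ρ n) := by
  by_cases hn : N ≤ n
  · exact hρ n hn
  · have h1 := hρ N le_rfl
    obtain ⟨u, hu⟩ := pref_isPrefix ρ (m := n + 1) (n := N) (by omega)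
    rw [← hu, pref_succ, List.append_assoc] at h1
    exact h.of_append u h1

/-! ### Winning in sub-arenas, and traps for Player 1. -/

namespace MullerGame

/-- Player 0 wins from `v` in the sub-arena `X`. -/
def Wins (G : MullerGame V) (X : Set V) (v : V) : Prop :=
  ∃ T : List V → V → Prop, T [] v ∧ G.arena.IsTree X T ∧ PrefixClosed T ∧
    ∀ ρ : ℕ → V, (∀ n, T (pref ρ n) (ρ n)) → infSet ρ ∈ G.𝓕0

/-- The winning tree is cut down to words inside the rest. No move of Player 0 is lost, since her
edges inside `X` cannot enter the attractor. -/
theorem Wins.rest {G : MullerGame V} {X B : Set V} {v : V} (h : G.Wins X v)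
    (hv : v ∈ G.arena.rest X B) : G.Wins (G.arena.rest X B) v := by
  obtain ⟨T, h0, hT, hp, hw⟩ := h
  refine ⟨fun w x => T w x ∧ x ∈ G.arena.rest X B ∧ ∀ a ∈ w, a ∈ G.arena.rest X B,
    ⟨h0, hv, by simp⟩, ?_, ?_, fun ρ hρ => hw ρ fun n => (hρ n).1⟩
  · rintro w x ⟨h1, h2, h3⟩
    have h4 : ∀ a ∈ w ++ [x], a ∈ G.arena.rest X B := by
      intro a ha
      rcases List.mem_append.1 ha with h | h
      · exact h3 a h
      · rwa [List.mem_singleton.1 h]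
    refine ⟨h2, fun hx => ?_, fun hx y hy he => ?_⟩
    · obtain ⟨y, hy, he, hTy⟩ := (hT w x h1).2.1 hx
      have := Arena.mem_rest_of_edge h2 hx hy he
      exact ⟨y, this, he, hTy, this, h4⟩
    · exact ⟨(hT w x h1).2.2 hx y hy.1 he, hy, h4⟩
  · rintro w x y ⟨h1, h2, h3⟩
    exact ⟨hp _ _ _ h1, h3 x (by simp), fun a ha => h3 a (by simp [ha])⟩

/-- The vertices that are reached after the prefix `p` in a winning tree form a trap for Player 1
in which Player 0 wins. -/
theorem wins_reach {G : MullerGame V} {X : Set V} {T : List V → V → Prop} (hX : G.arena.IsSub X)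
    (hT : G.arena.IsTree X T) (hp : PrefixClosed T)
    (hw : ∀ ρ : ℕ → V, (∀ n, T (pref ρ n) (ρ n)) → infSet ρ ∈ G.𝓕0) (p : List V) :
    let U := {x | ∃ u, T (p ++ u) x}
    U ⊆ X ∧ G.arena.IsSub U ∧ (∀ x ∈ U, x ∉ G.arena.V0 → ∀ y ∈ X, G.arena.E x y → y ∈ U) ∧
      ∀ x ∈ U, G.Wins U x := by
  intro U
  have hUX : U ⊆ X := fun x ⟨u, hu⟩ => (hT _ _ hu).1
  have htrap : ∀ x ∈ U, x ∉ G.arena.V0 → ∀ y ∈ X, G.arena.E x y → y ∈ U := by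
    rintro x ⟨u, hu⟩ h0 y hy he
    exact ⟨u ++ [x], by simpa using (hT _ _ hu).2.2 h0 y hy he⟩
  refine ⟨hUX, ?_, htrap, ?_⟩
  · rintro x ⟨u, hu⟩
    obtain ⟨y, -, he, hTy⟩ := hT.exists_next hX hu
    exact ⟨y, ⟨u ++ [x], by simpa using hTy⟩, he⟩
  · rintro x ⟨u, hu⟩
    refine ⟨fun w y => T (p ++ u ++ w) y, by simpa using hu, ?_, ?_, ?_⟩
    · intro w y hy
      refine ⟨⟨u ++ w, by simpa using hy⟩, fun h0 => ?_, fun h0 z hz he => ?_⟩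
      · obtain ⟨z, hz, he, hTz⟩ := (hT _ _ hy).2.1 h0
        rw [List.append_assoc] at hTz
        exact ⟨z, ⟨u ++ (w ++ [y]), by simpa using hTz⟩, he, hTz⟩
      · simpa using (hT _ _ hy).2.2 h0 z (hUX hz) he
    · intro w y z h
      exact hp _ _ z (by simpa using h)
    · intro ρ hρ
      let q := p ++ u
      -- Prepending `q` turns a branch of the shifted tree into a branch of `T` with the same
      -- infinity set.
      let ρ' : ℕ → V := fun n => if h : n < q.length then q[n] else ρ (n - q.length)
      have hsh : (fun n => ρ' (q.length + n)) = ρ := by funext n; simp [ρ']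
      have hq : pref ρ' q.length = q := by
        apply List.ext_getElem (by simp [length_pref])
        intro i h1 h2
        simp [pref, ρ', h2]
      have hpre : ∀ n, pref ρ' (q.length + n) = q ++ pref ρ n := by
        intro n
        induction n with
        | zero => simpa [pref_zero] using hq
        | succ n ih =>
          rw [← add_assoc, pref_succ, ih, pref_succ, List.append_assoc, ← congrFun hsh n]
      rw [← hsh, infSet_shift]
      refine hw ρ' (hp.branch (N := q.length) fun n hn => ?_)
      obtain ⟨k, rfl⟩ := Nat.exists_eq_add_of_le hn
      rw [hpre, congrFun hsh k]
      exact hρ k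

/-- If every vertex of `X` can be reached again and again, then some branch visits exactly the
vertices of `X` infinitely often. -/
theorem exists_branch_infSet_eq [Finite V] {X : Set V} {T : List V → V → Prop}
    (hp : PrefixClosed T) (hTX : ∀ w x, T w x → x ∈ X)
    (hR : ∀ w x, T w x → ∀ y ∈ X, ∃ u, T (w ++ x :: u) y) {v : V} (h0 : T [] v) :
    ∃ ρ : ℕ → V, (∀ n, T (pref ρ n) (ρ n)) ∧ infSet ρ = X := by
  obtain ⟨f, hf⟩ := (Set.to_countable X).exists_eq_range ⟨v, hTX _ _ h0⟩
  -- Unpairing makes every element of `X` a target infinitely often; `st n` extends the word so as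
  -- to reach the targets in turn.
  let g : ℕ → V := fun n => f n.unpair.1
  have hg : ∀ n, g n ∈ X := fun n => by rw [hf]; exact ⟨_, rfl⟩
  choose! r hr using hR
  let st : ℕ → List V × V := fun n => Nat.rec ([], v)
    (fun k p => (p.1 ++ p.2 :: r p.1 p.2 (g k), g k)) n
  have hs : ∀ n, st (n + 1) = ((st n).1 ++ (st n).2 :: r (st n).1 (st n).2 (g n), g n) :=
    fun n => rfl
  have hT : ∀ n, T (st n).1 (st n).2 := by
    intro n
    induction n with
    | zero => exact h0
    | succ n ih => rw [hs]; exact hr _ _ ih _ (hg n)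
  have hWs : ∀ n, (st n).1 ++ [(st n).2] <+: (st (n + 1)).1 := fun n => by
    rw [hs]; exact ⟨r (st n).1 (st n).2 (g n), by simp⟩
  have hlen : ∀ n, n ≤ (st n).1.length := by
    intro n
    induction n with
    | zero => exact Nat.zero_le _
    | succ n ih => have := (hWs n).length_le; simp at this; omega
  have hmono : ∀ m n, m ≤ n → (st m).1 <+: (st n).1 := by
    intro m n h
    induction n, h using Nat.le_induction with
    | base => exact List.prefix_refl _
    | succ n _ ih => exact ih.trans ((List.prefix_append _ _).trans (hWs n))
  let ρ : ℕ → V := fun n => ((st (n + 1)).1)[n]'(hlen (n + 1))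
  have hρ : ∀ n i (h : i < (st n).1.length), (st n).1[i] = ρ i := by
    intro n i h
    rcases le_total n (i + 1) with h' | h'
    · exact (hmono _ _ h').getElem h
    · exact ((hmono _ _ h').getElem (hlen (i + 1))).symm
  have hpre : ∀ n, pref ρ (st n).1.length = (st n).1 := by
    intro n
    apply List.ext_getElem (by simp [length_pref])
    intro i h1 h2
    rw [hρ n i h2]
    simp [pref]
  have hlast : ∀ n, ρ (st n).1.length = (st n).2 := by
    intro n
    have h1 : (st n).1.length < (st (n + 1)).1.length := by
      have := (hWs n).length_le; simp at this; omega
    rw [← hρ (n + 1) _ h1, ← (hWs n).getElem (by simp)]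
    simp
  have hbr : ∀ n, T (pref ρ n) (ρ n) := by
    intro n
    rcases (hlen n).eq_or_lt with h | h
    · have := hT n
      rwa [← hpre, ← hlast, ← h] at this
    · have h1 := hT n
      obtain ⟨u, hu⟩ := pref_isPrefix ρ (m := n + 1) h
      rw [← hpre n, ← hu, pref_succ, List.append_assoc] at h1
      exact hp.of_append u h1
  refine ⟨ρ, hbr, Set.Subset.antisymm ?_ ?_⟩
  · intro x hx
    obtain ⟨m, -, rfl⟩ := hx 0
    exact hTX _ _ (hbr m)
  · intro x hx n
    rw [hf] at hx
    obtain ⟨k, rfl⟩ := hx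
    have h1 : n ≤ Nat.pair k n := Nat.right_le_pair k n
    refine ⟨_, h1.trans ((Nat.le_succ _).trans (hlen (Nat.pair k n + 1))), ?_⟩
    refine (hlast (Nat.pair k n + 1)).trans ?_
    rw [hs]
    simp [g]

/-- If Player 0 wins but does not like `X`, then she wins in a proper trap for Player 1. -/
theorem exists_trap {G : MullerGame V} {X : Set V} (hX : G.arena.IsSub X) (hX0 : X ∉ G.𝓕0) {v : V}
    (hv : G.Wins X v) : ∃ U, U ⊆ X ∧ U ≠ X ∧ U.Nonempty ∧ G.arena.IsSub U ∧
      (∀ x ∈ U, x ∉ G.arena.V0 → ∀ y ∈ X, G.arena.E x y → y ∈ U) ∧ ∀ x ∈ U, G.Wins U x := by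
  have := G.arena.finite
  obtain ⟨T, h0, hT, hp, hw⟩ := hv
  by_contra hcon
  have hR : ∀ w x, T w x → ∀ y ∈ X, ∃ u, T (w ++ x :: u) y := by
    intro w x hwx y hy
    by_contra hy'
    -- The vertices reached after `w ++ [x]` miss `y`, so they form a proper trap.
    obtain ⟨h1, h2, h3, h4⟩ := wins_reach hX hT hp hw (w ++ [x])
    refine hcon ⟨_, h1, ?_, ?_, h2, h3, h4⟩
    · intro h
      rw [← h] at hy
      obtain ⟨u, hu⟩ := hy
      exact hy' ⟨u, by simpa using hu⟩
    · obtain ⟨z, -, -, hz⟩ := hT.exists_next hX hwx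
      exact ⟨z, [], by simpa using hz⟩
  obtain ⟨ρ, hρ, h⟩ := exists_branch_infSet_eq hp (fun w x h => (hT w x h).1) hR h0
  exact hX0 (h ▸ hw ρ hρ)

end MullerGame

/-! ## Bounding the scores by two -/

/-- The score of `F` is at most 2, and if it is 2, then it cannot increase while only vertices in
`R` are visited. -/
def Bounded (F R : Set V) (w : List V) : Prop :=
  score F w ≤ 1 ∨ (score F w = 2 ∧ ∃ a ∈ F, a ∉ acc F w ∧ a ∉ R)

/-- The score of `F` is 0, or it is 1 and the accumulator is empty. -/
def Fresh (F : Set V) (w : List V) : Prop :=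
  score F w = 0 ∨ (score F w = 1 ∧ acc F w = ∅)

theorem Fresh.le_one {F : Set V} {w : List V} (h : Fresh F w) : score F w ≤ 1 := by
  rcases h with h | h <;> omega

theorem Bounded.le_two {F R : Set V} {w : List V} (h : Bounded F R w) : score F w ≤ 2 := by
  rcases h with h | h <;> omega

/-- A score of 2 cannot rise, because the missing vertex `a` lies outside `R` and so differs from
`v`. When the score rises from 1 to 2, the accumulator is empty, and the new missing vertex is `v`
itself or an element of `F` outside `R'`. -/
theorem Bounded.snoc {F R R' : Set V} {w : List V} (h : Bounded F R w) {v : V} (hv : v ∈ R)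
    (hR : R' ⊆ R) (hF : v ∉ R' ∨ ¬ F ⊆ R') : Bounded F R' (w ++ [v]) := by
  by_cases hvF : v ∈ F
  · by_cases ha : acc F w = F \ {v}
    · obtain ⟨h1, h2⟩ := score_snoc_of_eq hvF ha
      rcases h with h | ⟨-, a, haF, hacc, haR⟩
      · by_cases h3 : score F w = 0
        · exact Or.inl (by omega)
        · refine Or.inr ⟨by omega, ?_⟩
          rw [h2]
          rcases hF with hF | hF
          · exact ⟨v, hvF, Set.notMem_empty _, hF⟩
          · obtain ⟨a, h4, h5⟩ := Set.not_subset.1 hF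
            exact ⟨a, h4, Set.notMem_empty _, h5⟩
      · refine absurd ?_ hacc
        rw [ha]
        exact ⟨haF, fun h => haR (h ▸ hv)⟩
    · obtain ⟨h1, h2⟩ := score_snoc_of_ne hvF ha
      rcases h with h | ⟨h, a, haF, hacc, haR⟩
      · exact Or.inl (by omega)
      · refine Or.inr ⟨by omega, a, haF, ?_, fun h => haR (hR h)⟩
        rw [h2]
        rintro (h3 | h3)
        exacts [hacc h3, haR (h3 ▸ hv)]
  · have := (score_snoc_of_notMem hvF w).1
    exact Or.inl (by omega)

theorem fresh_snoc {F : Set V} {w : List V} (h : score F w = 0) (v : V) :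
    Fresh F (w ++ [v]) := by
  by_cases hvF : v ∈ F
  · by_cases ha : acc F w = F \ {v}
    · obtain ⟨h1, h2⟩ := score_snoc_of_eq hvF ha
      exact Or.inr ⟨by omega, h2⟩
    · exact Or.inl ((score_snoc_of_ne hvF ha).1.trans h)
  · exact Or.inl (score_snoc_of_notMem hvF w).1

/-- The score of `F` is at most 1, and if it is 1, then the accumulator is contained in `Y`. -/
def Low (F Y : Set V) (w : List V) : Prop :=
  score F w = 0 ∨ (score F w = 1 ∧ acc F w ⊆ Y)

theorem Low.bounded {F Y : Set V} {w : List V} (h : Low F Y w) (R : Set V) : Bounded F R w :=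
  Or.inl (by rcases h with h | h <;> omega)

theorem Fresh.low {F : Set V} {w : List V} (h : Fresh F w) (Y : Set V) : Low F Y w := by
  rcases h with h | ⟨h1, h2⟩
  exacts [Or.inl h, Or.inr ⟨h1, h2 ▸ Set.empty_subset _⟩]

/-- Raising the score from 1 to 2 would require `F` to lie in the accumulator together with `v`,
hence in `Y`. -/
theorem Low.snoc {F Y : Set V} {w : List V} (h : Low F Y w) (hF : ¬ F ⊆ Y) {v : V} (hv : v ∈ Y) :
    Low F Y (w ++ [v]) := by
  rcases h with h | ⟨h1, h2⟩
  · exact (fresh_snoc h v).low Y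
  · by_cases hvF : v ∈ F
    · by_cases ha : acc F w = F \ {v}
      · refine absurd (fun a ha' => ?_) hF
        by_cases hav : a = v
        · rwa [hav]
        · exact h2 (ha ▸ ⟨ha', hav⟩)
      · obtain ⟨h3, h4⟩ := score_snoc_of_ne hvF ha
        refine Or.inr ⟨h3.trans h1, ?_⟩
        rw [h4]
        exact Set.union_subset h2 (by simpa using hv)
    · exact Or.inl (score_snoc_of_notMem hvF w).1

namespace MullerGame

/-- The sets in `X` whose scores Player 0 has to bound. -/
def bad (G : MullerGame V) (X : Set V) : Set (Set V) := {F | F ∉ G.𝓕0 ∧ F ⊆ X}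

/-- After the word `w ++ [x]`, Player 0 can keep the scores at most 2 in `X`. -/
def CanBound (G : MullerGame V) (X : Set V) (w : List V) (x : V) : Prop :=
  ∃ T : List V → V → Prop, T w x ∧ G.arena.IsTree X T ∧
    ∀ w x, T w x → ∀ F ∈ G.bad X, score F (w ++ [x]) ≤ 2

theorem CanBound.le_two {G : MullerGame V} {X : Set V} {w : List V} {x : V}
    (h : G.CanBound X w x) {F : Set V} (hF : F ∈ G.bad X) : score F (w ++ [x]) ≤ 2 := by
  obtain ⟨T, h0, -, h⟩ := h
  exact h _ _ h0 _ hF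

theorem CanBound.cpre {G : MullerGame V} {X : Set V} {w : List V} {x : V}
    (h : G.CanBound X w x) : G.arena.CPre X (G.CanBound X (w ++ [x])) x := by
  obtain ⟨T, h0, hT, h⟩ := h
  exact (hT _ _ h0).2.mono fun y _ _ hy => ⟨T, hy, hT, h⟩

/-- The situation while Player 0 tries to reach `B`: either the play stays in the complement of
the attractor, or it moves through the attractor. -/
def Approach (G : MullerGame V) (X B : Set V) (w : List V) (x : V) : Prop :=
  (x ∈ G.arena.rest X B ∧ G.CanBound (G.arena.rest X B) w x ∧
    ∀ F ∈ G.bad X, ¬ F ⊆ G.arena.rest X B → Low F (G.arena.rest X B) (w ++ [x])) ∨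
  ∃ n, x ∈ G.arena.attr X B (n + 1) ∧ x ∉ G.arena.attr X B n ∧
    ∀ F ∈ G.bad X, Bounded F (G.arena.attr X B n) (w ++ [x])

theorem Approach.le_two {G : MullerGame V} {X B : Set V} {w : List V} {x : V}
    (h : G.Approach X B w x) {F : Set V} (hF : F ∈ G.bad X) : score F (w ++ [x]) ≤ 2 := by
  rcases h with ⟨-, h1, h2⟩ | ⟨n, -, -, h⟩
  · by_cases hY : F ⊆ G.arena.rest X B
    · exact h1.le_two ⟨hF.1, hY⟩
    · exact ((h2 F hF hY).bounded ∅).le_two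
  · exact (h F hF).le_two

theorem Approach.mem {G : MullerGame V} {X B : Set V} (hB : B ⊆ X) {w : List V} {x : V}
    (h : G.Approach X B w x) : x ∈ X ∧ x ∉ B := by
  rcases h with ⟨h, -, -⟩ | ⟨n, h1, h2, -⟩
  · exact ⟨h.1, h.2 0⟩
  · exact ⟨G.arena.attr_subset hB _ h1, fun h => h2 (G.arena.attr_mono X B (Nat.zero_le n) h)⟩

/-- Arriving in a stage of the attractor. -/
theorem approach_snoc {G : MullerGame V} {X B R : Set V} {w : List V} {y : V} {n : ℕ}
    (hy : y ∈ G.arena.attr X B n) (hR : G.arena.attr X B n ⊆ R)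
    (h : ∀ F ∈ G.bad X, y ∉ F ∨ Bounded F R w) :
    G.Approach X B w y ∨
      (y ∈ B ∧ ∀ F ∈ G.bad X, ¬ F ⊆ B → Bounded F B (w ++ [y])) := by
  classical
  have key : ∀ R' ⊆ R, ∀ F ∈ G.bad X, y ∉ R' ∨ ¬ F ⊆ R' → Bounded F R' (w ++ [y]) := by
    intro R' hR' F hF hyF
    rcases h F hF with h | h
    · exact Or.inl ((score_snoc_of_notMem h w).1.trans_le zero_le_one)
    · exact h.snoc (hR hy) hR' hyF
  have hex : ∃ n, y ∈ G.arena.attr X B n := ⟨n, hy⟩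
  -- The least stage containing `y` is used: stage 0 means arrival in `B`; otherwise `y` is outside
  -- the previous stage and can serve as the missing vertex of `Bounded`.
  have hle : Nat.find hex ≤ n := Nat.find_min' hex hy
  have hm := Nat.find_spec hex
  rcases hk : Nat.find hex with _ | k
  · rw [hk] at hm
    exact Or.inr ⟨hm, fun F hF hFB =>
      key B ((G.arena.attr_mono X B (Nat.zero_le n)).trans hR) F hF (Or.inr hFB)⟩
  · rw [hk] at hm
    have hk' : y ∉ G.arena.attr X B k := Nat.find_min hex (by omega)
    exact Or.inl (Or.inr ⟨k, hm, hk', fun F hF =>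
      key _ ((G.arena.attr_mono X B (by omega)).trans hR) F hF (Or.inl hk')⟩)

theorem mem_rest_or_attr {G : MullerGame V} {X : Set V} (B : Set V) {x : V} (hx : x ∈ X) :
    x ∈ G.arena.rest X B ∨ ∃ n, x ∈ G.arena.attr X B n := by
  by_cases h : ∃ n, x ∈ G.arena.attr X B n
  · exact Or.inr h
  · exact Or.inl ⟨hx, not_exists.1 h⟩

/-- In the rest, the strategy for the smaller arena controls the sets inside it, and `Low` controls
the others. Only Player 1 may leave for the attractor, which kills the scores of the sets inside the
rest. In the attractor the stage decreases at each step. -/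
theorem Approach.cpre {G : MullerGame V} {X B : Set V} {w : List V} {x : V}
    (h : G.Approach X B w x) :
    G.arena.CPre X (fun y => G.Approach X B (w ++ [x]) y ∨
      (y ∈ B ∧ ∀ F ∈ G.bad X, ¬ F ⊆ B → Bounded F B (w ++ [x] ++ [y]))) x := by
  rcases h with ⟨hx, h1, h2⟩ | ⟨n, hx, hxn, h⟩
  · have hstay : ∀ y ∈ G.arena.rest X B, G.CanBound (G.arena.rest X B) (w ++ [x]) y →
        G.Approach X B (w ++ [x]) y := fun y hy hc =>
      Or.inl ⟨hy, hc, fun F hF hFY => (h2 F hF hFY).snoc hFY hy⟩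
    refine ⟨fun h0 => ?_, fun h0 y hy he => ?_⟩
    · obtain ⟨y, hy, he, hc⟩ := h1.cpre.1 h0
      exact ⟨y, hy.1, he, Or.inl (hstay y hy hc)⟩
    · rcases mem_rest_or_attr B hy with hy' | ⟨n, hn⟩
      · exact Or.inl (hstay y hy' (h1.cpre.2 h0 y hy' he))
      · refine approach_snoc hn (Set.subset_univ _) fun F hF => ?_
        by_cases hFY : F ⊆ G.arena.rest X B
        · exact Or.inl fun hyF => (hFY hyF).2 n hn
        · exact Or.inr ((h2 F hF hFY).bounded _)
  · have hc : G.arena.CPre X (· ∈ G.arena.attr X B n) x := by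
      rcases hx with hx | hx
      exacts [absurd hx hxn, hx.2]
    exact hc.mono fun y _ _ hy => approach_snoc hy subset_rfl fun F hF => Or.inr (h F hF)

theorem approach_of_fresh {G : MullerGame V} {X B : Set V} {w : List V} {x : V} (hx : x ∈ X)
    (hxB : x ∉ B) (h : ∀ F ∈ G.bad X, Fresh F (w ++ [x]))
    (ih : x ∈ G.arena.rest X B → G.CanBound (G.arena.rest X B) w x) : G.Approach X B w x := by
  classical
  rcases mem_rest_or_attr (G := G) B hx with hx' | hex
  · exact Or.inl ⟨hx', ih hx', fun F hF _ => (h F hF).low _⟩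
  · have hm := Nat.find_spec hex
    rcases hk : Nat.find hex with _ | k
    · rw [hk] at hm
      exact absurd hm hxB
    · rw [hk] at hm
      exact Or.inr ⟨k, hm, Nat.find_min hex (by omega), fun F hF => ((h F hF).low ∅).bounded _⟩

end MullerGame

/-! ### The induction on sub-arenas. -/

namespace MullerGame

/-- If Player 0 wins everywhere in the sub-arena `X`, then she can keep the scores at most 2 after
every word with fresh scores. -/
def Bounding (G : MullerGame V) (X : Set V) : Prop :=
  G.arena.IsSub X → (∀ v ∈ X, G.Wins X v) →
    ∀ w, ∀ x ∈ X, (∀ F ∈ G.bad X, Fresh F (w ++ [x])) → G.CanBound X w x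

/-- Player 0 attracts to a proper trap `U` in which she wins, and never leaves it. Both `U` and the
complement of its attractor are smaller arenas, to which induction applies. Sets not contained in
`U` have a vertex that is never visited again after entering `U`. -/
theorem bounding_of_notMem {G : MullerGame V} {X : Set V} (hX : X ∉ G.𝓕0)
    (ih : ∀ Y, Y ⊂ X → G.Bounding Y) : G.Bounding X := by
  intro hsub hwin w₀ x₀ hx₀ hfresh
  obtain ⟨U, hUX, hUne, ⟨u, hu⟩, hUsub, htrap, hUwin⟩ := exists_trap hsub hX (hwin x₀ hx₀)
  have hU := ih U (hUX.ssubset_of_ne hUne) hUsub hUwin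
  have hY : G.Bounding (G.arena.rest X U) := ih _
    ⟨G.arena.rest_subset X U, fun h => (h (hUX hu)).2 0 hu⟩
  let T : List V → V → Prop := fun w x => G.Approach X U w x ∨ (x ∈ U ∧ G.CanBound U w x ∧
    ∀ F ∈ G.bad X, ¬ F ⊆ U → Bounded F U (w ++ [x]))
  refine ⟨T, ?_, ?_, ?_⟩
  · by_cases hxU : x₀ ∈ U
    · exact Or.inr ⟨hxU, hU _ _ hxU fun F hF => hfresh F ⟨hF.1, hF.2.trans hUX⟩,
        fun F hF _ => ((hfresh F hF).low ∅).bounded _⟩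
    · exact Or.inl (approach_of_fresh hx₀ hxU hfresh fun hxY =>
        hY (hsub.rest U) (fun v hv => (hwin v hv.1).rest hv) _ _ hxY fun F hF =>
          hfresh F ⟨hF.1, hF.2.trans (G.arena.rest_subset X U)⟩)
  · rintro w x (h | ⟨hx, h1, h2⟩)
    · refine ⟨(h.mem hUX).1, h.cpre.mono fun y _ _ => ?_⟩
      rintro (h' | ⟨hy, h'⟩)
      · exact Or.inl h'
      · refine Or.inr ⟨hy, hU _ _ hy fun F hF => fresh_snoc ?_ y, h'⟩
        exact (score_snoc_of_notMem (fun hxF => (h.mem hUX).2 (hF.2 hxF)) w).1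
    · have hgo : ∀ y ∈ U, G.CanBound U (w ++ [x]) y → T (w ++ [x]) y := fun y hy hc =>
        Or.inr ⟨hy, hc, fun F hF hFU => (h2 F hF hFU).snoc hy subset_rfl (Or.inr hFU)⟩
      refine ⟨hUX hx, fun h0 => ?_, fun h0 y hy he => ?_⟩
      · obtain ⟨y, hy, he, hc⟩ := h1.cpre.1 h0
        exact ⟨y, hUX hy, he, hgo y hy hc⟩
      · have hyU := htrap x hx h0 y hy he
        exact hgo y hyU (h1.cpre.2 h0 y hyU he)
  · rintro w x (h | ⟨hx, h1, h2⟩) F hF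
    · exact h.le_two hF
    · by_cases hFU : F ⊆ U
      · exact h1.le_two ⟨hF.1, hFU⟩
      · exact (h2 F hF hFU).le_two

/-- Some bad set contains the accumulators of all bad sets and all bad sets with a positive
score. -/
theorem exists_bad_maximal {G : MullerGame V} {X : Set V} (w : List V) {x : V}
    (hx : ∃ F ∈ G.bad X, x ∈ F) : ∃ C ∈ G.bad X, x ∈ C ∧ ∀ F ∈ G.bad X,
      acc F (w ++ [x]) ⊆ C ∧ (score F (w ++ [x]) ≠ 0 → F ⊆ C) := by
  classical
  -- The longest suffix whose letters lie in one bad set determines `C`. Accumulators, and sets with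
  -- positive score, are letter sets of suffixes, and those coming from bad sets are no longer than
  -- this one.
  let P : ℕ → Prop := fun n => ∃ s, s <:+ w ++ [x] ∧ s.length = n ∧ ∃ C ∈ G.bad X, ∀ a ∈ s, a ∈ C
  have hP1 : P 1 := by
    obtain ⟨F, hF, hxF⟩ := hx
    exact ⟨[x], List.suffix_append _ _, rfl, F, hF, by simpa using hxF⟩
  have hle : 1 ≤ (w ++ [x]).length := by simp
  obtain ⟨s, hs, hlen, C, hC, hsC⟩ : P (Nat.findGreatest P (w ++ [x]).length) :=
    Nat.findGreatest_spec hle hP1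
  have hmax : ∀ t, t <:+ w ++ [x] → (∃ D ∈ G.bad X, ∀ a ∈ t, a ∈ D) → t <:+ s := by
    rintro t ht hD
    refine List.suffix_of_suffix_length_le ht hs ?_
    rw [hlen]
    exact Nat.le_findGreatest ht.length_le ⟨t, ht, rfl, hD⟩
  refine ⟨C, hC, ?_, fun F hF => ⟨?_, fun h0 => ?_⟩⟩
  · obtain ⟨F, hF, hxF⟩ := hx
    exact hsC x ((hmax [x] (List.suffix_append _ _) ⟨F, hF, by simpa using hxF⟩).subset (by simp))
  · obtain ⟨t, ht, h⟩ := exists_suffix_acc F (w ++ [x])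
    have h1 := hmax t ht ⟨F, hF, fun a ha => acc_subset F (w ++ [x]) (h ▸ ha)⟩
    rw [h]
    exact fun a ha => hsC a (h1.subset ha)
  · obtain ⟨t, ht, h⟩ := exists_suffix_of_score_ne_zero h0
    have h1 := hmax t ht ⟨F, hF, fun a ha => h ▸ ha⟩
    rw [h]
    exact fun a ha => hsC a (h1.subset ha)

/-- The play runs in rounds that start with fresh scores. In each round Player 0 attracts to `X \
C`, with `C` from `exists_bad_maximal`. A round may last forever, with scores at most 2; if it ends,
the scores are fresh again. -/
theorem bounding_of_mem {G : MullerGame V} {X : Set V} (hX : X ∈ G.𝓕0)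
    (ih : ∀ Y, Y ⊂ X → G.Bounding Y) : G.Bounding X := by
  intro hsub hwin w₀ x₀ hx₀ hfresh
  -- During a round the play stays in `C`, so a bad set not contained in `C` keeps score 0 and an
  -- accumulator inside `C`.
  let T₁ : List V → V → Prop := fun w x => ∃ C ∈ G.bad X, G.Approach X (X \ C) w x ∧
    ∀ F ∈ G.bad X, ¬ F ⊆ C → score F (w ++ [x]) = 0 ∧ acc F (w ++ [x]) ⊆ C
  let T : List V → V → Prop := fun w x =>
    (x ∈ X ∧ ∀ F ∈ G.bad X, Fresh F (w ++ [x])) ∨ T₁ w x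
  have hT₁ : ∀ w x, T₁ w x → x ∈ X ∧ G.arena.CPre X (T (w ++ [x])) x := by
    rintro w x ⟨C, hC, h1, h2⟩
    have hxX := h1.mem Set.sdiff_subset
    have hxC : x ∈ C := by_contra fun h => hxX.2 ⟨hxX.1, h⟩
    refine ⟨hxX.1, h1.cpre.mono fun y hyX _ => ?_⟩
    rintro (h | ⟨⟨-, hyC⟩, -⟩)
    · have hyC : y ∈ C := by_contra fun h' => (h.mem Set.sdiff_subset).2 ⟨hyX, h'⟩
      refine Or.inr ⟨C, hC, h, fun F hF hFC => ?_⟩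
      obtain ⟨h3, h4⟩ := h2 F hF hFC
      by_cases hyF : y ∈ F
      · by_cases ha : acc F (w ++ [x]) = F \ {y}
        · refine absurd (fun a haF => ?_) hFC
          by_cases hay : a = y
          · rwa [hay]
          · exact h4 (ha ▸ ⟨haF, hay⟩)
        · obtain ⟨h5, h6⟩ := score_snoc_of_ne hyF ha
          exact ⟨h5.trans h3, h6 ▸ Set.union_subset h4 (by simpa using hyC)⟩
      · obtain ⟨h5, h6⟩ := score_snoc_of_notMem hyF (w ++ [x])
        exact ⟨h5, h6 ▸ Set.empty_subset _⟩
    -- Leaving `C` ends the round: sets inside `C` drop to score 0, and the others had score 0 one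
    -- step before.
    · refine Or.inl ⟨hyX, fun F hF => ?_⟩
      by_cases hFC : F ⊆ C
      · exact Or.inl (score_snoc_of_notMem (fun h => hyC (hFC h)) _).1
      · exact fresh_snoc (h2 F hF hFC).1 y
  refine ⟨T, Or.inl ⟨hx₀, hfresh⟩, ?_, ?_⟩
  · rintro w x (⟨hx, h⟩ | h)
    · by_cases hbad : ∃ F ∈ G.bad X, x ∈ F
      · obtain ⟨C, hC, hxC, hmax⟩ := exists_bad_maximal w hbad
        refine hT₁ w x ⟨C, hC, approach_of_fresh hx (fun h' : x ∈ X \ C => h'.2 hxC) h fun hxY => ?_,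
          fun F hF hFC => ⟨not_not.1 fun h0 => hFC ((hmax F hF).2 h0), (hmax F hF).1⟩⟩
        have hne : ¬ X ⊆ C := fun hXC => hC.1 (hC.2.antisymm hXC ▸ hX)
        obtain ⟨z, hzX, hzC⟩ := Set.not_subset.1 hne
        refine ih _ ⟨G.arena.rest_subset X _, fun h' => (h' hzX).2 0 (show z ∈ X \ C from ⟨hzX, hzC⟩)⟩ (hsub.rest _)
          (fun v hv => (hwin v hv.1).rest hv) _ _ hxY fun F hF => ?_
        exact h F ⟨hF.1, hF.2.trans (G.arena.rest_subset X _)⟩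
      · have hgo : ∀ y ∈ X, T (w ++ [x]) y := fun y hy => Or.inl ⟨hy, fun F hF =>
          fresh_snoc (score_snoc_of_notMem (fun hxF => hbad ⟨F, hF, hxF⟩) w).1 y⟩
        refine ⟨hx, fun _ => ?_, fun _ y hy _ => hgo y hy⟩
        obtain ⟨y, hy, he⟩ := hsub x hx
        exact ⟨y, hy, he, hgo y hy⟩
    · exact hT₁ w x h
  · rintro w x (⟨-, h⟩ | ⟨C, -, h, -⟩) F hF
    · exact (h F hF).le_one.trans one_le_two
    · exact h.le_two hF

theorem bounding (G : MullerGame V) (X : Set V) : G.Bounding X := by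
  have := G.arena.finite
  induction X using (wellFounded_lt (α := Set V)).induction with
  | _ X ih =>
    by_cases hX : X ∈ G.𝓕0
    · exact bounding_of_mem hX ih
    · exact bounding_of_notMem hX ih

end MullerGame

/-! ## Consistent words -/

/-- The words `w ++ [x]` that start in `v` and are consistent with the moves `mv` of Player 0. -/
inductive Arena.Consistent (A : Arena V) (mv : List V → V → Set V) (v : V) : List V → V → Prop
  | start : Consistent A mv v [] v
  | step {w : List V} {x y : V} : Consistent A mv v w x → A.E x y → (x ∈ A.V0 → y ∈ mv w x) →
      Consistent A mv v (w ++ [x]) y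

/-- The plays that start in `v` and are consistent with the moves `mv` of Player 0. -/
def Arena.plays (A : Arena V) (mv : List V → V → Set V) (v : V) : Set (ℕ → V) :=
  {ρ | A.IsPlay ρ ∧ ρ 0 = v ∧ ∀ n, ρ n ∈ A.V0 → ρ (n + 1) ∈ mv (pref ρ n) (ρ n)}

namespace Arena

variable {A : Arena V} {mv : List V → V → Set V} {v : V}

theorem Consistent.eq_of_nil {y : V} (h : A.Consistent mv v [] y) : y = v := by
  generalize hw : ([] : List V) = w at h
  cases h with
  | start => rfl
  | step _ _ _ => simp at hw

theorem Consistent.of_snoc {w : List V} {x y : V} (h : A.Consistent mv v (w ++ [x]) y) :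
    A.Consistent mv v w x ∧ A.E x y ∧ (x ∈ A.V0 → y ∈ mv w x) := by
  generalize hw : w ++ [x] = w' at h
  cases h with
  | start => simp at hw
  | step h1 h2 h3 =>
    obtain ⟨rfl, h⟩ := List.append_inj' hw rfl
    obtain rfl := List.singleton_inj.1 h
    exact ⟨h1, h2, h3⟩

theorem prefixClosed_consistent : PrefixClosed (A.Consistent mv v) :=
  fun _ _ _ h => h.of_snoc.1

theorem isTree_consistent (hne : ∀ w x, x ∈ A.V0 → (mv w x).Nonempty)
    (he : ∀ w x, x ∈ A.V0 → ∀ y ∈ mv w x, A.E x y) :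
    A.IsTree Set.univ (A.Consistent mv v) := by
  refine fun w x h => ⟨trivial, fun h0 => ?_, fun h0 y _ hy => h.step hy fun h => absurd h h0⟩
  obtain ⟨y, hy⟩ := hne w x h0
  exact ⟨y, trivial, he w x h0 y hy, h.step (he w x h0 y hy) fun _ => hy⟩

theorem isSub_univ (A : Arena V) : A.IsSub Set.univ := fun x _ =>
  let ⟨y, hy⟩ := A.exists_succ x; ⟨y, trivial, hy⟩

theorem mem_plays_iff {ρ : ℕ → V} :
    ρ ∈ A.plays mv v ↔ ∀ n, A.Consistent mv v (pref ρ n) (ρ n) := by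
  constructor
  · rintro ⟨h1, rfl, h2⟩ n
    induction n with
    | zero => exact .start
    | succ n ih => rw [pref_succ]; exact ih.step (h1 n) (h2 n)
  · intro h
    have hs : ∀ n, A.E (ρ n) (ρ (n + 1)) ∧ (ρ n ∈ A.V0 → ρ (n + 1) ∈ mv (pref ρ n) (ρ n)) := by
      intro n
      have := h (n + 1)
      rw [pref_succ] at this
      exact this.of_snoc.2
    exact ⟨fun n => (hs n).1, (h 0).eq_of_nil, fun n => (hs n).2⟩

theorem exists_play (hne : ∀ w x, x ∈ A.V0 → (mv w x).Nonempty)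
    (he : ∀ w x, x ∈ A.V0 → ∀ y ∈ mv w x, A.E x y) {w : List V} {x : V}
    (h : A.Consistent mv v w x) :
    ∃ ρ ∈ A.plays mv v, pref ρ w.length = w ∧ ρ w.length = x := by
  obtain ⟨ρ, h1, h2, h3⟩ := exists_branch (T := A.Consistent mv v) (fun w x h =>
    let ⟨y, _, _, hy⟩ := (isTree_consistent hne he).exists_next A.isSub_univ h; ⟨y, hy⟩) h
  exact ⟨ρ, mem_plays_iff.2 (prefixClosed_consistent.branch h3), h1, h2⟩

end Arena

/-! ## Safety games -/

namespace SafetyGame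

/-- Choosing one successor inside `Q` at each vertex of Player 0 gives a positional winning
strategy. -/
theorem subset_W0 {S : SafetyGame V} {Q : Set V} (hF : Q ⊆ S.F)
    (h : ∀ q ∈ Q, S.arena.CPre Set.univ (· ∈ Q) q) : Q ⊆ S.W0 := by
  classical
  have : ∀ q, ∃ q', S.arena.E q q' ∧ (q ∈ Q → q ∈ S.arena.V0 → q' ∈ Q) := by
    intro q
    by_cases hq : q ∈ Q ∧ q ∈ S.arena.V0
    · obtain ⟨q', -, he, hq'⟩ := (h q hq.1).1 hq.2
      exact ⟨q', he, fun _ _ => hq'⟩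
    · obtain ⟨q', he⟩ := S.arena.exists_succ q
      exact ⟨q', he, fun h1 h2 => absurd ⟨h1, h2⟩ hq⟩
  choose f hf using this
  intro q hq
  refine ⟨⟨fun _ x => f x, fun _ x _ => (hf x).1⟩, ?_⟩
  rintro ρ ⟨h1, rfl, h2⟩
  have hQ : ∀ n, ρ n ∈ Q := by
    intro n
    induction n with
    | zero => exact hq
    | succ n ih =>
      by_cases h0 : ρ n ∈ S.arena.V0
      · rw [h2 n h0]; exact (hf _).2 ih h0
      · exact (h _ ih).2 h0 _ trivial (h1 n)
  rintro _ ⟨n, rfl⟩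
  exact hF (hQ n)

theorem mem_of_mem_W0 {S : SafetyGame V} {q : V} (h : q ∈ S.W0) : q ∈ S.F := by
  obtain ⟨σ, hσ⟩ := h
  obtain ⟨ρ, hρ, -, h0⟩ := Arena.exists_play (A := S.arena) (mv := fun w x => {σ.move w x})
    (fun _ _ _ => Set.singleton_nonempty _) (by rintro w x h0 y rfl; exact σ.edge w x h0)
    (Arena.Consistent.start (v := q))
  exact h0 ▸ hσ hρ ⟨_, rfl⟩

/-- After one consistent move, the residual strategy, which treats `q` as past history, still wins.
-/
theorem cpre_W0 {S : SafetyGame V} {q : V} (h : q ∈ S.W0) :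
    S.arena.CPre Set.univ (· ∈ S.W0) q := by
  obtain ⟨σ, hσ⟩ := h
  have key : ∀ q', S.arena.E q q' → (q ∈ S.arena.V0 → q' = σ.move [] q) → q' ∈ S.W0 := by
    intro q' he hq'
    refine ⟨⟨fun w x => σ.move (q :: w) x, fun w x => σ.edge _ x⟩, ?_⟩
    rintro ρ ⟨h1, rfl, h2⟩
    let ρ' : ℕ → V := fun n => Nat.casesOn n q ρ
    have hp : ∀ n, pref ρ' (n + 1) = q :: pref ρ n := by
      intro n
      simp only [pref, List.range_succ_eq_map, List.map_cons, List.map_map]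
      rfl
    have hρ' : ρ' ∈ σ.Beh q := by
      refine ⟨?_, rfl, ?_⟩
      · rintro (_ | n)
        exacts [he, h1 n]
      · rintro (_ | n) h0
        · exact hq' h0
        · rw [hp]; exact h2 n h0
    rintro _ ⟨n, rfl⟩
    exact hσ hρ' ⟨n + 1, rfl⟩
  exact ⟨fun h0 => ⟨_, trivial, σ.edge [] q h0, key _ (σ.edge [] q h0) fun _ => rfl⟩,
    fun h0 y _ he => key y he fun h => absurd h h0⟩

end SafetyGame

/-! ## The vertices of the safety game of a Muller game -/

namespace MullerGame

theorem maxScoreWord_lt_three_iff {𝓕 : Set (Set V)} {w : List V} :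
    maxScoreWord 𝓕 w < 3 ↔ ∀ F ∈ 𝓕, ∀ w', w' <+: w → score F w' ≤ 2 := by
  constructor
  · intro h F hF w' hw'
    have : (score F w' : ℕ∞) < 3 := (score_le_maxScoreWord hF hw').trans_lt h
    have : score F w' < 3 := by exact_mod_cast this
    omega
  · intro h
    refine lt_of_le_of_lt (b := 2) ?_ (by norm_num)
    exact iSup₂_le fun F hF => iSup₂_le fun w' hw' => by exact_mod_cast h F hF w' hw'

theorem maxScoreWord_snoc_lt_three {𝓕 : Set (Set V)} {w : List V} {v : V}
    (h : maxScoreWord 𝓕 w < 3) (hv : ∀ F ∈ 𝓕, score F (w ++ [v]) ≤ 2) :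
    maxScoreWord 𝓕 (w ++ [v]) < 3 := by
  rw [maxScoreWord_lt_three_iff] at h ⊢
  intro F hF w' hw'
  rcases List.prefix_concat_iff.1 hw' with rfl | hw'
  exacts [hv F hF, h F hF w' hw']

variable {G : MullerGame V}

/-- All proper prefixes of a word in `playsLE` have scores at most 2, so only the final scores
matter. This makes safety a property of the class. -/
theorem mem_playsLT_iff {w : List V} (hw : w ∈ G.playsLE) :
    w ∈ G.playsLT ↔ ∀ F ∈ G.𝓕1, score F w ≤ 2 := by
  refine ⟨fun h F hF => maxScoreWord_lt_three_iff.1 h.2 F hF w (List.prefix_refl w), fun h => ?_⟩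
  rcases hw with hw | ⟨u, v, rfl, -, hp, hu, -⟩
  · exact hw
  · exact ⟨hp, maxScoreWord_snoc_lt_three (hu.trans_lt (by norm_num)) h⟩

theorem cls_eq_iff {w w' : G.playsLE} : G.cls w = G.cls w' ↔
    w.1.getLast? = w'.1.getLast? ∧ ∀ F ∈ G.𝓕1, scoreAcc F w.1 = scoreAcc F w'.1 := by
  constructor
  · intro h
    have h' := ScoreEquiv.eq (Quotient.exact h)
    exact ⟨h'.1, fun F hF => Prod.ext (h'.2 F hF).1 (h'.2 F hF).2⟩
  · rintro ⟨h1, h2⟩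
    refine Quotient.sound ⟨⟨h1, fun F hF => Or.inr ?_⟩, ⟨h1.symm, fun F hF => Or.inr ?_⟩⟩ <;>
    simp [score, acc, h2 F hF]

theorem cls_snoc_eq {w w' : G.playsLE} (h : G.cls w = G.cls w') {v : V}
    (hw : w.1 ++ [v] ∈ G.playsLE) (hw' : w'.1 ++ [v] ∈ G.playsLE) :
    G.cls ⟨w.1 ++ [v], hw⟩ = G.cls ⟨w'.1 ++ [v], hw'⟩ := by
  rw [cls_eq_iff] at h ⊢
  refine ⟨by simp, fun F hF => ?_⟩
  simp only [scoreAcc_snoc, h.2 F hF]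

theorem mem_playsLT_of_cls_eq {w w' : G.playsLE} (h : G.cls w = G.cls w')
    (hw : w.1 ∈ G.playsLT) : w'.1 ∈ G.playsLT := by
  rw [mem_playsLT_iff w.2] at hw
  rw [mem_playsLT_iff w'.2]
  intro F hF
  have := hw F hF
  rwa [score, (cls_eq_iff.1 h).2 F hF] at this

theorem cls_mem_safe {w : G.playsLE} : G.cls w ∈ G.safe ↔ w.1 ∈ G.playsLT :=
  ⟨fun ⟨_, h, hw⟩ => mem_playsLT_of_cls_eq h.symm hw, fun h => ⟨w, rfl, h⟩⟩

theorem cls_mem_V0S {w : G.playsLE} {x : V} (hx : w.1.getLast? = some x) :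
    G.cls w ∈ G.V0S ↔ x ∈ G.arena.V0 := by
  constructor
  · rintro ⟨w', h, y, hy, hl⟩
    rw [← (cls_eq_iff.1 h).1, hx] at hl
    rwa [Option.some.inj hl]
  · exact fun h => ⟨w, rfl, x, h, hx⟩

theorem ES_cls_iff {w : G.playsLE} (hw : w.1 ∈ G.playsLT) {x : V} (hx : w.1.getLast? = some x)
    {q : G.VS} : G.ES (G.cls w) q ↔
      ∃ y, G.arena.E x y ∧ ∃ h : w.1 ++ [y] ∈ G.playsLE, q = G.cls ⟨w.1 ++ [y], h⟩ := by
  constructor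
  · rintro (⟨u, u', h, rfl, hu, a, y, ha, he, hu'⟩ | ⟨h, -⟩)
    · rw [← (cls_eq_iff.1 h).1, hx] at ha
      obtain rfl := Option.some.inj ha
      obtain ⟨u', hu''⟩ := u'
      obtain rfl : u' = u.1 ++ [y] := hu'
      exact ⟨y, he, G.snoc_mem_playsLE hw hx he, (cls_snoc_eq h _ _).symm⟩
    · exact absurd (cls_mem_safe.2 hw) h
  · rintro ⟨y, he, h, rfl⟩
    exact Or.inl ⟨w, _, rfl, rfl, hw, x, y, hx, he, rfl⟩

/-- The word `w` is a vertex of the winning region of the safety game. -/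
def Safe (G : MullerGame V) (w : List V) : Prop :=
  ∃ h : w ∈ G.playsLE, G.cls ⟨w, h⟩ ∈ G.safetyGame.W0

theorem Safe.mem_playsLT {w : List V} (h : G.Safe w) : w ∈ G.playsLT := by
  obtain ⟨hw, h⟩ := h
  exact cls_mem_safe.1 (SafetyGame.mem_of_mem_W0 h)

theorem Safe.cpre {w : List V} {x : V} (h : G.Safe (w ++ [x])) :
    G.arena.CPre Set.univ (fun y => G.Safe (w ++ [x] ++ [y])) x := by
  have hLT := h.mem_playsLT
  obtain ⟨hw, h⟩ := h
  have hc := SafetyGame.cpre_W0 h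
  have hx : (w ++ [x]).getLast? = some x := by simp
  refine ⟨fun h0 => ?_, fun h0 y _ he => ?_⟩
  · obtain ⟨q, -, he, hq⟩ := hc.1 ((cls_mem_V0S hx).2 h0)
    obtain ⟨y, hy, hwy, rfl⟩ := (ES_cls_iff hLT hx).1 he
    exact ⟨y, trivial, hy, hwy, hq⟩
  · have hwy := G.snoc_mem_playsLE hLT hx he
    exact ⟨hwy, hc.2 (fun h => h0 ((cls_mem_V0S hx).1 h)) _ trivial
      ((ES_cls_iff hLT hx).2 ⟨y, he, hwy, rfl⟩)⟩

/-- The classes of the words in the tree form a set of safe vertices in which Player 0 can stay. A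
class may come from several words; the moves at any one of them suffice. -/
theorem safe_of_tree {T : List V → V → Prop} (hT : G.arena.IsTree Set.univ T)
    (hs : ∀ w x, T w x → ∀ F ∈ G.𝓕1, score F (w ++ [x]) ≤ 2) {w : List V} {x : V} (h : T w x)
    (hw : w ++ [x] ∈ G.playsLT) : G.Safe (w ++ [x]) := by
  let Q : Set G.VS := {q | ∃ w x, ∃ h : w ++ [x] ∈ G.playsLT, T w x ∧ q = G.cls ⟨_, Or.inl h⟩}
  refine ⟨Or.inl hw, SafetyGame.subset_W0 (Q := Q) ?_ ?_ ⟨w, x, hw, h, rfl⟩⟩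
  · rintro _ ⟨w, x, hw, -, rfl⟩
    exact cls_mem_safe.2 hw
  · rintro _ ⟨w, x, hw, h, rfl⟩
    have hx : (w ++ [x]).getLast? = some x := by simp
    have hLT : ∀ y, G.arena.E x y → T (w ++ [x]) y → w ++ [x] ++ [y] ∈ G.playsLT :=
      fun y he hy => (mem_playsLT_iff (G.snoc_mem_playsLE hw hx he)).2 (hs _ _ hy)
    refine ⟨fun h0 => ?_, fun h0 q _ he => ?_⟩
    · obtain ⟨y, -, he, hy⟩ := (hT w x h).2.1 ((cls_mem_V0S hx).1 h0)
      exact ⟨G.cls ⟨_, Or.inl (hLT y he hy)⟩, trivial,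
        (ES_cls_iff hw hx).2 ⟨y, he, Or.inl (hLT y he hy), rfl⟩, _, _, hLT y he hy, hy, rfl⟩
    · obtain ⟨y, hxy, hwy, rfl⟩ := (ES_cls_iff (w := ⟨w ++ [x], Or.inl hw⟩) hw hx).1 he
      have hy := (hT w x h).2.2 (fun h => h0 ((cls_mem_V0S hx).2 h)) y trivial hxy
      exact ⟨_, _, hLT y hxy hy, hy, rfl⟩

/-! ### Sources of safe words: winning vertices and bounded behaviours. -/

theorem fresh_singleton (F : Set V) (v : V) : Fresh F [v] := fresh_snoc (w := []) rfl v

theorem singleton_mem_playsLT (G : MullerGame V) (v : V) : [v] ∈ G.playsLT := by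
  refine ⟨⟨by simp, by simp⟩, maxScoreWord_lt_three_iff.2 fun F _ w' hw' => ?_⟩
  rcases List.prefix_concat_iff (l₂ := []).1 hw' with rfl | hw'
  · exact (fresh_singleton F v).le_one.trans one_le_two
  · rw [List.prefix_nil.1 hw']; exact Nat.zero_le _

theorem safe_of_mem_W0 {v : V} (h : v ∈ G.W0) : G.Safe [v] := by
  obtain ⟨σ, hσ⟩ := h
  let mv : List V → V → Set V := fun w x => {σ.move w x}
  have hT : G.arena.IsTree Set.univ (G.arena.Consistent mv v) :=
    Arena.isTree_consistent (fun _ _ _ => Set.singleton_nonempty _)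
      (by rintro w x h0 y rfl; exact σ.edge w x h0)
  obtain ⟨-, hsub, htrap, hwin⟩ := wins_reach G.arena.isSub_univ hT
    Arena.prefixClosed_consistent (fun ρ hρ => hσ (Arena.mem_plays_iff.2 hρ)) []
  -- The vertices reachable under the winning strategy form a trap for Player 1 in which Player 0
  -- wins everywhere, so `bounding` applies.
  set X := {x | ∃ u, G.arena.Consistent mv v ([] ++ u) x}
  have hvX : v ∈ X := ⟨[], .start⟩
  obtain ⟨T, h0, hT, hs⟩ := G.bounding X hsub hwin [] v hvX fun F _ => fresh_singleton F v
  refine safe_of_tree (T := fun w x => T w x ∧ ∀ a ∈ w, a ∈ X) (w := []) ?_ ?_ ⟨h0, by simp⟩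
    (G.singleton_mem_playsLT v)
  · rintro w x ⟨hwx, hwX⟩
    obtain ⟨hx, h1, h2⟩ := hT w x hwx
    have hwX' : ∀ a ∈ w ++ [x], a ∈ X := by
      intro a ha
      rcases List.mem_append.1 ha with ha | ha
      exacts [hwX a ha, List.mem_singleton.1 ha ▸ hx]
    exact ⟨trivial, fun hx0 => let ⟨y, _, he, hy⟩ := h1 hx0; ⟨y, trivial, he, hy, hwX'⟩,
      fun hx0 y _ he => ⟨h2 hx0 y (htrap x hx hx0 y trivial he) he, hwX'⟩⟩
  · rintro w x ⟨hwx, hwX⟩ F hF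
    -- `bounding` only concerns subsets of `X`; a positive score forces `F` to consist of visited
    -- vertices, all in `X`.
    by_cases h0 : score F (w ++ [x]) = 0
    · omega
    · obtain ⟨s, hsw, rfl⟩ := exists_suffix_of_score_ne_zero h0
      refine hs w x hwx _ ⟨hF.2, fun a ha => ?_⟩
      rcases List.mem_append.1 (hsw.subset ha) with ha | ha
      exacts [hwX a ha, List.mem_singleton.1 ha ▸ (hT w x hwx).1]

theorem pref_mem_playsLT {ρ : ℕ → V} (hρ : G.arena.IsPlay ρ)
    (h : ∀ F ∈ G.𝓕1, ∀ n, score F (pref ρ n) ≤ 2) (n : ℕ) : pref ρ (n + 1) ∈ G.playsLT := by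
  induction n with
  | zero => exact G.singleton_mem_playsLT (ρ 0)
  | succ n ih =>
    have hl : (pref ρ (n + 1)).getLast? = some (ρ n) := by simp [pref_succ]
    rw [pref_succ]
    refine (mem_playsLT_iff (G.snoc_mem_playsLE ih hl (hρ n))).2 fun F hF => ?_
    rw [← pref_succ]
    exact h F hF _

theorem safe_of_beh {σ : MultiStrategy G.arena} {v : V}
    (h : ∀ ρ ∈ σ.Beh v, maxScore G.𝓕1 ρ ≤ 2) {ρ : ℕ → V} (hρ : ρ ∈ σ.Beh v) (n : ℕ) :
    G.Safe (pref ρ (n + 1)) := by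
  have hT := Arena.isTree_consistent (v := v) σ.nonempty σ.edge
  have hs : ∀ ρ ∈ σ.Beh v, ∀ F ∈ G.𝓕1, ∀ n, score F (pref ρ n) ≤ 2 := fun ρ hρ F hF n => by
    exact_mod_cast (le_iSup₂_of_le F hF (le_iSup_of_le n le_rfl)).trans (h ρ hρ)
  rw [pref_succ]
  refine safe_of_tree hT ?_ (Arena.mem_plays_iff.1 hρ n) ?_
  · intro w x hwx F hF
    obtain ⟨ρ', hρ', h1, h2⟩ := Arena.exists_play σ.nonempty σ.edge hwx
    have := hs ρ' hρ' F hF (w.length + 1)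
    rwa [pref_succ, h1, h2] at this
  · rw [← pref_succ]
    exact pref_mem_playsLT hρ.1 (hs ρ hρ) n

end MullerGame

/-! ## The permissive multi-strategy -/

theorem MemoryStructure.updateStar_snoc {M : Type*} (mem : MemoryStructure V M) (w : List V)
    (x y : V) : mem.updateStar (w ++ [x]) y = mem.update (mem.updateStar w x) y := by
  cases w <;> simp [updateStar]

namespace MullerGame

variable {G : MullerGame V}

/-- A representative of a memory state. -/
noncomputable def rep (m : G.safetyGame.W0) : List V := (Quotient.out (s := G.setoid) m.1).1

open Classical in
/-- The class of `w` as a memory state if `w` is in the winning region of the safety game, and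
`m₀` otherwise. -/
noncomputable def state (m₀ : G.safetyGame.W0) (w : List V) : G.safetyGame.W0 :=
  if h : G.Safe w then ⟨G.cls ⟨w, h.1⟩, h.2⟩ else m₀

theorem state_of_safe (m₀ : G.safetyGame.W0) {w : List V} (h : G.Safe w) :
    state m₀ w = ⟨G.cls ⟨w, h.1⟩, h.2⟩ := dif_pos h

theorem state_of_not_safe (m₀ : G.safetyGame.W0) {w : List V} (h : ¬ G.Safe w) :
    state m₀ w = m₀ := dif_neg h

theorem cls_out (m : G.safetyGame.W0) : G.cls (Quotient.out (s := G.setoid) m.1) = m.1 :=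
  Quotient.out_eq (s := G.setoid) m.1

theorem safe_rep (m : G.safetyGame.W0) : G.Safe (rep m) := by
  refine ⟨(Quotient.out (s := G.setoid) m.1).2, ?_⟩
  have := m.2
  rw [← cls_out m] at this
  exact this

theorem rep_state (m₀ : G.safetyGame.W0) {w : List V} (h : G.Safe w) :
    G.cls ⟨rep (state m₀ w), (safe_rep _).1⟩ = G.cls ⟨w, h.1⟩ :=
  (cls_out (state m₀ w)).trans (congrArg Subtype.val (state_of_safe m₀ h))

theorem getLast?_rep_state (m₀ : G.safetyGame.W0) {w : List V} (h : G.Safe w) :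
    (rep (state m₀ w)).getLast? = w.getLast? := (cls_eq_iff.1 (rep_state m₀ h)).1

/-- Equivalent words are continued by the same letters in the winning region. -/
theorem safe_snoc_of_cls_eq {w w' : List V} (hw : w ∈ G.playsLE) (hw' : w' ∈ G.playsLT)
    (h : G.cls ⟨w, hw⟩ = G.cls ⟨w', Or.inl hw'⟩) {x y : V} (hx : w.getLast? = some x)
    (he : G.arena.E x y) (hy : G.Safe (w ++ [y])) :
    ∃ hy' : G.Safe (w' ++ [y]), G.cls ⟨_, hy.1⟩ = G.cls ⟨_, hy'.1⟩ := by
  have hx' : w'.getLast? = some x := (cls_eq_iff.1 h).1.symm.trans hx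
  have hle := G.snoc_mem_playsLE hw' hx' he
  have heq : G.cls ⟨_, hy.1⟩ = G.cls ⟨_, hle⟩ :=
    cls_snoc_eq (w := ⟨w, hw⟩) (w' := ⟨w', Or.inl hw'⟩) h hy.1 hle
  exact ⟨⟨hle, heq ▸ hy.2⟩, heq⟩

theorem safe_rep_snoc_iff (m₀ : G.safetyGame.W0) {w : List V} (h : G.Safe w) {x y : V}
    (hx : w.getLast? = some x) (he : G.arena.E x y) :
    G.Safe (rep (state m₀ w) ++ [y]) ↔ G.Safe (w ++ [y]) :=
  ⟨fun hy => (safe_snoc_of_cls_eq _ h.mem_playsLT (rep_state m₀ h)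
    ((getLast?_rep_state m₀ h).trans hx) he hy).1,
  fun hy => (safe_snoc_of_cls_eq _ (safe_rep _).mem_playsLT (rep_state m₀ h).symm hx he hy).1⟩

/-- The update may thus be computed from any representative. The new word need not be safe:
otherwise both sides are the default `m₀`. -/
theorem state_rep_snoc (m₀ : G.safetyGame.W0) {w : List V} (h : G.Safe w) {x y : V}
    (hx : w.getLast? = some x) (he : G.arena.E x y) :
    state m₀ (rep (state m₀ w) ++ [y]) = state m₀ (w ++ [y]) := by
  by_cases hy : G.Safe (w ++ [y])
  · obtain ⟨hy', heq⟩ :=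
      safe_snoc_of_cls_eq _ (safe_rep _).mem_playsLT (rep_state m₀ h).symm hx he hy
    rw [state_of_safe m₀ hy, state_of_safe m₀ hy']
    exact Subtype.ext heq.symm
  · rw [state_of_not_safe m₀ hy, state_of_not_safe m₀ (mt (safe_rep_snoc_iff m₀ h hx he).1 hy)]

/-- The memory structure that keeps track of the class of the play prefix. -/
noncomputable def memory (m₀ : G.safetyGame.W0) : MemoryStructure V G.safetyGame.W0 where
  finite := have := G.finite_VS; Subtype.finite
  init v := state m₀ [v]
  update m v := state m₀ (rep m ++ [v])

/-- The next-move function that allows all moves within the winning region of the safety game. -/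
def nextMove (G : MullerGame V) : NextMove G.arena G.safetyGame.W0 where
  -- Memory states whose last vertex is not `v` impose no constraint, which keeps the set of moves
  -- non-empty.
  next v m := {y | G.arena.E v y ∧ ((rep m).getLast? = some v → G.Safe (rep m ++ [y]))}
  nonempty v m hv := by
    by_cases h : (rep m).getLast? = some v
    · obtain ⟨w, hw⟩ := List.getLast?_eq_some_iff.1 h
      have hs := safe_rep m
      rw [hw] at hs
      obtain ⟨y, -, he, hy⟩ := hs.cpre.1 hv
      exact ⟨y, he, fun _ => hw ▸ hy⟩
    · obtain ⟨y, hy⟩ := G.arena.exists_succ v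
      exact ⟨y, hy, fun h' => absurd h' h⟩
  edge _ _ _ _ h := h.1

theorem updateStar_memory (m₀ : G.safetyGame.W0) {ρ : ℕ → V} (hρ : G.arena.IsPlay ρ) {n : ℕ}
    (h : ∀ k < n, G.Safe (pref ρ (k + 1))) :
    (memory m₀).updateStar (pref ρ n) (ρ n) = state m₀ (pref ρ (n + 1)) := by
  induction n with
  | zero => rfl
  | succ n ih =>
    rw [pref_succ ρ n, MemoryStructure.updateStar_snoc, ih fun k hk => h k (by omega),
      pref_succ ρ (n + 1)]
    exact state_rep_snoc m₀ (h n (by omega)) (x := ρ n) (by simp [pref_succ]) (hρ n)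

/-- Otherwise the infinity set would be a loop of Player 1, whose score eventually reaches 3. -/
theorem win_of_safe {ρ : ℕ → V} (hρ : G.arena.IsPlay ρ) (h : ∀ n, G.Safe (pref ρ (n + 1))) :
    ρ ∈ G.Win := by
  have := G.arena.finite
  by_contra hcon
  obtain ⟨N, hN⟩ := exists_le_score_infSet ρ 3
  have h1 := hN (N + 1) (Nat.le_succ N)
  have h2 := (mem_playsLT_iff (h N).1).1 (h N).mem_playsLT (infSet ρ) ⟨hρ.isLoop_infSet, hcon⟩
  omega

theorem mem_next_iff (m₀ : G.safetyGame.W0) {ρ : ℕ → V} (hρ : G.arena.IsPlay ρ) {n : ℕ}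
    (h : ∀ k ≤ n, G.Safe (pref ρ (k + 1))) :
    ρ (n + 1) ∈ ((memory m₀).implement G.nextMove).move (pref ρ n) (ρ n) ↔
      G.Safe (pref ρ (n + 2)) := by
  have hl : (pref ρ (n + 1)).getLast? = some (ρ n) := by simp [pref_succ]
  change ρ (n + 1) ∈ G.nextMove.next _ _ ↔ _
  rw [updateStar_memory m₀ hρ fun k hk => h k hk.le, pref_succ ρ (n + 1),
    ← safe_rep_snoc_iff m₀ (h n le_rfl) hl (hρ n)]
  exact ⟨fun hy => hy.2 ((getLast?_rep_state m₀ (h n le_rfl)).trans hl),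
    fun hy => ⟨hρ n, fun _ => hy⟩⟩

theorem isPermissive_memory (m₀ : G.safetyGame.W0) :
    G.IsPermissive ((memory m₀).implement G.nextMove) := by
  constructor
  · rintro v hv ρ ⟨hρ, rfl, hm⟩
    refine win_of_safe hρ fun n => ?_
    induction n using Nat.strong_induction_on with
    | _ n ih =>
      rcases n with _ | n
      · exact safe_of_mem_W0 hv
      · have ih' : ∀ k ≤ n, G.Safe (pref ρ (k + 1)) := fun k hk => ih k (by omega)
        -- Moves of Player 0 are safe by the choice of `nextMove`; moves of Player 1 cannot leave
        -- the winning region.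
        by_cases h0 : ρ n ∈ G.arena.V0
        · exact (mem_next_iff m₀ hρ ih').1 (hm n h0)
        · have hn := ih' n le_rfl
          rw [pref_succ] at hn
          rw [pref_succ, pref_succ]
          exact hn.cpre.2 h0 _ trivial (hρ n)
  · intro σ v h ρ hρ
    exact ⟨hρ.1, hρ.2.1, fun n _ =>
      (mem_next_iff m₀ hρ.1 fun k _ => safe_of_beh h hρ k).2 (safe_of_beh h hρ _)⟩

/-- If the winning region of the safety game is empty, then every multi-strategy is permissive. -/
theorem isPermissive_of_eq_empty (h : G.safetyGame.W0 = ∅) (σ' : MultiStrategy G.arena) :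
    G.IsPermissive σ' := by
  have hS : ∀ w, ¬ G.Safe w := by
    rintro w ⟨_, hw⟩
    rw [h] at hw
    exact hw
  exact ⟨fun v hv => absurd (safe_of_mem_W0 hv) (hS _),
    fun σ v hσ ρ hρ => absurd (safe_of_beh hσ hρ 0) (hS _)⟩

end MullerGame
end MullerPermissive

theorem mainTheorem3 {V : Type*} (G : MullerPermissive.MullerGame V) :
    (G.safetyGame.W0.Nonempty →
      ∃ (mem : MullerPermissive.MemoryStructure V G.safetyGame.W0)
        (nxt : MullerPermissive.NextMove G.arena G.safetyGame.W0),
        G.IsPermissive (mem.implement nxt)) ∧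
    (G.safetyGame.W0 = ∅ →
      ∃ (mem : MullerPermissive.MemoryStructure V Unit)
        (nxt : MullerPermissive.NextMove G.arena Unit),
        G.IsPermissive (mem.implement nxt)) := by
  refine ⟨fun ⟨m, hm⟩ => ⟨_, _, MullerPermissive.MullerGame.isPermissive_memory ⟨m, hm⟩⟩,
    fun h => ?_⟩
  exact ⟨⟨inferInstance, fun _ => (), fun _ _ => ()⟩,
    ⟨fun v _ => {y | G.arena.E v y}, fun v _ _ => G.arena.exists_succ v, fun _ _ _ _ h => h⟩,
    MullerPermissive.MullerGame.isPermissive_of_eq_empty h _⟩
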